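/- Let $\mathbb{C}(\{t\})\subset\mathbb{C}((t))$ be the field of germs of meromorphic functions at $0$, i.e. the field of fractions of the ring of convergent power series at $0$. A Laurent series $w\in\mathbb{C}((t))$ is called differentially transcendental over $\mathbb{C}(\{t\})$ if for every $n\ge 0$ and every non-zero polynomial $P\in\mathbb{C}(\{t\})[X_0,\dots,X_n]$ one has $P(w,w',\dots,w^{(n)})\neq 0$, where $'=\frac{d}{dt}$. **Corollary 1.3.** Let $x,\gamma\in\mathbb{C}\setminus\{0\}$, and let $\hat F(x,t)=\sum_{n\ge 0}P_n(x)\frac{t^n}{n!}$ be one of the following exponential generating functions (the quotients being taken in $\mathbb{C}((t))$): - Bernoulli: $\dfrac{t}{e^t-1}\,e^{xt}$; - Glaisher: $\dfrac{t}{e^t+1}\,e^{xt}$; - Apostol–Bernoulli: $\dfrac{t}{\gamma e^t-1}\,e^{xt}$; - Imschenetsky: $\dfrac{t}{e^t-1}\,(e^{xt}-1)$, with $x\notin\mathbb{Z}$; - Euler: $\dfrac{2}{e^t+1}\,e^{xt}$; - Genocchi: $\dfrac{2t}{e^t+1}\,e^{xt}$; - Carlitz: $\dfrac{1-\gamma}{1-\gamma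 e^t}\,e^{xt}$, with $\gamma\neq 1$; - Fubini: $\dfrac{1}{1-x(e^t-1)}$, with $x\neq -1$; - Bell–Touchard: $\exp\big(x(e^t-1)\big)$; - Mahler: $\exp\big(x(1+t-e^t)\big)$; - Toscano: $\exp\big(-xe^t+\gamma t+x\big)$. Then the ordinary generating function $F(x,t)=\sum_{n\ge 0}P_n(x)\,t^n\in\mathbb{C}[[t]]$ is differentially transcendental over $\mathbb{C}(\{t\})$. (The Bell–Touchard row at $x=1$ and $x=-1$, the Genocchi row at $x=1$ and the Fubini row at $x=1$ are the ordinary generating functions of the Bell, Uppuluri–Carpenter, Genocchi and Fubini numbers.) -/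

import Mathlib

open scoped PowerSeries LaurentSeries

noncomputable section

namespace StrongDT

/-- A power series over `ℂ` is convergent (at `0`) if it converges absolutely at some radius
`r > 0`. -/
def IsConvergent (f : ℂ⟦X⟧) : Prop :=
  ∃ r : ℝ, 0 < r ∧ Summable fun n : ℕ => ‖PowerSeries.coeff n f‖ * r ^ n

/-- The field `ℂ({t})` of germs of meromorphic functions at `0`, realised inside the field
`ℂ((t))` of formal Laurent series: it is the subfield generated by the convergent power series.
As these form a subring, it is their field of fractions. -/
def meromorphicGerms : Subfield ℂ⸨X⸩ :=
  Subfield.closure {g : ℂ⸨X⸩ | ∃ f : ℂ⟦X⟧, IsConvergent f ∧ g = (f : ℂ⸨X⸩)}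

/-- `f` is differentially transcendental over `ℂ({t})`: for every `n` and every non-zero
polynomial `P ∈ ℂ({t})[X₀, …, Xₙ]` one has `P(f, f', …, f⁽ⁿ⁾) ≠ 0`, where `'` is `d/dt`. -/
def IsDifferentiallyTranscendental (f : ℂ⸨X⸩) : Prop :=
  ∀ (n : ℕ) (P : MvPolynomial (Fin (n + 1)) meromorphicGerms), P ≠ 0 →
    MvPolynomial.aeval (fun i : Fin (n + 1) => (LaurentSeries.derivative ℂ)^[(i : ℕ)] f) P ≠ 0

/-- The classical families of polynomials under consideration. -/
inductive Family : Type
  | bernoulli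
  | glaisher
  | apostolBernoulli
  | imschenetsky
  | euler
  | genocchi
  | carlitz
  | fubini
  | bellTouchard
  | mahler
  | toscano

/-- The series `t`. -/
def tt : ℂ⸨X⸩ := ((PowerSeries.X : ℂ⟦X⟧) : ℂ⸨X⸩)

/-- The series `exp (a t)`, for `a ∈ ℂ`. -/
def expMul (a : ℂ) : ℂ⸨X⸩ := ((PowerSeries.rescale a (PowerSeries.exp ℂ) : ℂ⟦X⟧) : ℂ⸨X⸩)

/-- The series `exp (g(t))`, for a power series `g` without constant term. -/
def expOf (g : ℂ⟦X⟧) : ℂ⸨X⸩ := ((PowerSeries.subst g (PowerSeries.exp ℂ) : ℂ⟦X⟧) : ℂ⸨X⸩)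

/-- The exponential generating function `∑ Pₙ(x) tⁿ / n!` of each family, at a complex number `x`
and, for the three families that depend on it, a complex parameter `γ`. The quotients are taken in
the field `ℂ((t))`; none of the denominators is zero. -/
def egf (F : Family) (x γ : ℂ) : ℂ⸨X⸩ :=
  match F with
  | .bernoulli => tt / (expMul 1 - 1) * expMul x
  | .glaisher => tt / (expMul 1 + 1) * expMul x
  | .apostolBernoulli => tt / (HahnSeries.C γ * expMul 1 - 1) * expMul x
  | .imschenetsky => tt / (expMul 1 - 1) * (expMul x - 1)
  | .euler => 2 / (expMul 1 + 1) * expMul x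
  | .genocchi => 2 * tt / (expMul 1 + 1) * expMul x
  | .carlitz => HahnSeries.C (1 - γ) / (1 - HahnSeries.C γ * expMul 1) * expMul x
  | .fubini => 1 / (1 - HahnSeries.C x * (expMul 1 - 1))
  | .bellTouchard => expOf (PowerSeries.C x * (PowerSeries.exp ℂ - 1))
  | .mahler => expOf (PowerSeries.C x * (1 + PowerSeries.X - PowerSeries.exp ℂ))
  | .toscano =>
      expOf (-PowerSeries.C x * PowerSeries.exp ℂ + PowerSeries.C γ * PowerSeries.X
        + PowerSeries.C x)

/-- The value `Pₙ(x)` of the `n`-th polynomial of the family (with parameter `γ`), that is `n!`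
times the coefficient of `tⁿ` in the exponential generating function. -/
def polyValue (F : Family) (γ : ℂ) (n : ℕ) (x : ℂ) : ℂ :=
  (n.factorial : ℂ) * (egf F x γ).coeff (n : ℤ)

/-- The ordinary generating function `F(x, t) = ∑ Pₙ(x) tⁿ`. -/
def ogf (F : Family) (x γ : ℂ) : ℂ⟦X⟧ :=
  PowerSeries.mk fun n => polyValue F γ n x

end StrongDT

end

/-!
Write `lap` for the formal Laplace transform `∑ aₙ tⁿ / n! ↦ ∑ aₙ tⁿ`, which sends an exponential
generating function `f` to the ordinary one, and `tau` for the endomorphism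
`g(t) ↦ g(t / (1 - t))` of `ℂ((t))`. Two facts drive the proof. First, `tau (t lap f) =
t lap (exp(t) f)` (`tau_X_mul_lap`), so that a relation between `f`, its derivative and
`exp(t) f` becomes a first order difference equation for `t lap f`. Second, `lap h` is convergent
exactly when `h` is an entire function of exponential type.

The series `yᵢ = t lap (tⁱ f)` are the iterated images of `t lap f` by the derivation `t² d/dt`, and
are related to the derivatives of `lap f` by an invertible triangular substitution over `ℂ({t})`
(`derivative_iterate_lap`). It is therefore enough to show that they are algebraically independent
over `ℂ({t})`. They satisfy a triangular affine system `tau yᵢ = a yᵢ + ∑ j < i, Nᵢⱼ yⱼ + bᵢ` over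
`ℂ({t})`. Take a monic polynomial relation `P` between them whose leading monomial, for a suitable
graded monomial order, is the least possible. The transform of `P` by `tau` is another relation, with
the same leading monomial, hence a multiple of `P`. Differentiating this proportionality gives linear
`tau`-equations for the values of the partial derivatives of `P` at `y`
(`IsMinimalRelation.tau_aeval_pderiv`), and there are two cases.

* For the first eight families, `(α exp(t) + β) f = N` with `α, β ≠ 0` and `N` a polynomial in `t`
  and exponentials. Here `a = -β / α` is constant and the `Nᵢⱼ` vanish, so each of these values is an
  eigenvector of `tau`, hence a constant (`eq_C_of_tau_eq`). By minimality, `P` is then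
  linear with constant coefficients, so that `lap (p f)` is convergent for some polynomial `p ≠ 0`,
  and `p f` is entire. This is impossible: `f` has infinitely many poles, at the zeros of
  `α exp(t) + β`.
* For the last three families, `f' = (γ - x exp(t)) f`. Here `a = (γ - 1 / t) / x` has a pole at `0`.
  If the degree of `P` is at least `2`, comparing orders at `0` shows that the partial derivatives of
  `P` vanish at `y` (`eq_zero_of_tau_eq`), against minimality. So `P` is linear, and since
  `g(t / (1 - t)) - g(t)` never has order exactly `1` (`tau_sub_ne`), `P` only involves `y₀`. Hence
  `lap f` is convergent, whereas `f = exp(-x exp(t) + γ t + x)` is not of exponential type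
  (`not_isConvergent_lap_exp_exp`).
-/

noncomputable section

namespace StrongDT

/-! ### Convergent power series -/

section

open PowerSeries

/-- Convergence amounts to a geometric bound on the coefficients. -/
theorem isConvergent_iff {f : ℂ⟦X⟧} :
    IsConvergent f ↔ ∃ C ρ : ℝ, 0 ≤ C ∧ 0 ≤ ρ ∧ ∀ n, ‖coeff n f‖ ≤ C * ρ ^ n := by
  constructor
  · rintro ⟨r, hr, h⟩
    refine ⟨∑' n, ‖coeff n f‖ * r ^ n, r⁻¹, tsum_nonneg fun n => by positivity, by positivity,
      fun n => ?_⟩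
    have := h.le_tsum n fun j _ => by positivity
    rw [inv_pow, ← div_eq_mul_inv, le_div_iff₀ (by positivity)]
    exact this
  · rintro ⟨C, ρ, hC, hρ, h⟩
    refine ⟨(2 * (ρ + 1))⁻¹, by positivity, ?_⟩
    refine Summable.of_nonneg_of_le (fun n => by positivity) (fun n => ?_)
      ((summable_geometric_of_lt_one (r := (1 / 2 : ℝ)) (by norm_num) (by norm_num)).mul_left C)
    calc ‖coeff n f‖ * (2 * (ρ + 1))⁻¹ ^ n ≤ C * ρ ^ n * (2 * (ρ + 1))⁻¹ ^ n := by
          gcongr; exact h n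
      _ ≤ C * (ρ + 1) ^ n * (2 * (ρ + 1))⁻¹ ^ n := by gcongr; linarith
      _ = C * (1 / 2) ^ n := by
          rw [mul_assoc, ← mul_pow]; congr 2; field_simp

theorem isConvergent_C (a : ℂ) : IsConvergent (C a) := by
  refine isConvergent_iff.2 ⟨‖a‖, 0, by positivity, le_rfl, fun n => ?_⟩
  rcases n with _ | n <;> simp [coeff_C]

theorem isConvergent_X : IsConvergent X := by
  refine isConvergent_iff.2 ⟨1, 1, by positivity, by simp, fun n => ?_⟩
  rw [coeff_X]; split_ifs <;> simp

theorem IsConvergent.add {f g : ℂ⟦X⟧} (hf : IsConvergent f) (hg : IsConvergent g) :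
    IsConvergent (f + g) := by
  obtain ⟨C, ρ, hC, hρ, h⟩ := isConvergent_iff.1 hf
  obtain ⟨D, σ, hD, hσ, k⟩ := isConvergent_iff.1 hg
  refine isConvergent_iff.2 ⟨C + D, ρ + σ, by positivity, by positivity, fun n => ?_⟩
  rw [map_add, add_mul]
  refine (norm_add_le _ _).trans (add_le_add ((h n).trans ?_) ((k n).trans ?_)) <;> gcongr <;>
    linarith

theorem IsConvergent.mul {f g : ℂ⟦X⟧} (hf : IsConvergent f) (hg : IsConvergent g) :
    IsConvergent (f * g) := by
  obtain ⟨C, ρ, hC, hρ, h⟩ := isConvergent_iff.1 hf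
  obtain ⟨D, σ, hD, hσ, k⟩ := isConvergent_iff.1 hg
  refine isConvergent_iff.2 ⟨C * D, ρ + σ, by positivity, by positivity, fun n => ?_⟩
  rw [coeff_mul, (Commute.all ρ σ).add_pow', Finset.mul_sum]
  refine (norm_sum_le _ _).trans (Finset.sum_le_sum fun p hp => ?_)
  rw [norm_mul]
  calc ‖coeff p.1 f‖ * ‖coeff p.2 g‖ ≤ (C * ρ ^ p.1) * (D * σ ^ p.2) := by
        gcongr; exacts [h _, k _]
    _ = C * D * (1 * (ρ ^ p.1 * σ ^ p.2)) := by ring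
    _ ≤ C * D * (n.choose p.1 • (ρ ^ p.1 * σ ^ p.2)) := by
        rw [nsmul_eq_mul]
        gcongr
        have : 0 < n.choose p.1 :=
          Nat.choose_pos (by have := Finset.HasAntidiagonal.mem_antidiagonal.1 hp; omega)
        exact_mod_cast this

/-- The ring of convergent power series. -/
def convergentSubring : Subring ℂ⟦X⟧ where
  carrier := {f | IsConvergent f}
  mul_mem' := IsConvergent.mul
  one_mem' := by simpa using isConvergent_C 1
  add_mem' := IsConvergent.add
  zero_mem' := by simpa using isConvergent_C 0
  neg_mem' {f} hf := by
    have := (isConvergent_C (-1)).mul hf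
    simpa using this

theorem IsConvergent.of_X_pow_mul {N : ℕ} {f : ℂ⟦X⟧} (h : IsConvergent (X ^ N * f)) :
    IsConvergent f := by
  obtain ⟨C, ρ, hC, hρ, h⟩ := isConvergent_iff.1 h
  refine isConvergent_iff.2 ⟨C * ρ ^ N, ρ, by positivity, hρ, fun n => ?_⟩
  have := h (n + N)
  rwa [coeff_X_pow_mul, pow_add, mul_comm (ρ ^ n), ← mul_assoc] at this

/-- A quotient of convergent power series that is a power series is convergent: the recursion for
its coefficients preserves geometric bounds. -/
theorem IsConvergent.of_mul_left {b f : ℂ⟦X⟧} (hb0 : b ≠ 0) (hb : IsConvergent b)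
    (hbf : IsConvergent (b * f)) : IsConvergent f := by
  obtain ⟨N, c, hc, rfl⟩ : ∃ (N : ℕ) (c : ℂ⟦X⟧), constantCoeff c ≠ 0 ∧ b = X ^ N * c :=
    ⟨b.order.toNat, b.divXPowOrder, by rwa [Ne, constantCoeff_divXPowOrder_eq_zero_iff],
      X_pow_order_mul_divXPowOrder.symm⟩
  rw [mul_assoc] at hbf
  obtain ⟨A, ρ, hA, hρ, hA'⟩ := isConvergent_iff.1 hbf.of_X_pow_mul
  obtain ⟨B, σ, hB, hσ, hB'⟩ := isConvergent_iff.1 hb.of_X_pow_mul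
  set β := ‖constantCoeff c‖ with hβ
  have hβ0 : 0 < β := norm_pos_iff.2 hc
  have hrec : ∀ n, β * ‖coeff n f‖ ≤
      A * (ρ + σ) ^ n + ∑ k ∈ Finset.range n, B * (ρ + σ) ^ (n - k) * ‖coeff k f‖ := fun n => by
    have h1 : constantCoeff c * coeff n f =
        coeff n (c * f) - ∑ k ∈ Finset.range n, coeff (n - k) c * coeff k f := by
      rw [mul_comm c f, coeff_mul, Finset.Nat.sum_antidiagonal_eq_sum_range_succ_mk,
        Finset.sum_range_succ]
      simp [mul_comm]
    rw [hβ, ← norm_mul, h1]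
    refine (norm_sub_le _ _).trans (add_le_add ((hA' n).trans (by gcongr; linarith))
      ((norm_sum_le _ _).trans (Finset.sum_le_sum fun k _ => ?_)))
    rw [norm_mul]
    gcongr
    exact (hB' _).trans (by gcongr; linarith)
  refine isConvergent_iff.2 ⟨A / β, (ρ + σ) * (1 + B / β), by positivity, by positivity,
    fun n => ?_⟩
  induction n using Nat.strong_induction_on with
  | _ n ih =>
    rw [← mul_le_mul_iff_right₀ hβ0]
    calc β * ‖coeff n f‖
        ≤ A * (ρ + σ) ^ n + ∑ k ∈ Finset.range n, B * (ρ + σ) ^ (n - k) *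
          (A / β * ((ρ + σ) * (1 + B / β)) ^ k) := by
          refine (hrec n).trans ?_
          gcongr with k hk
          exact ih k (Finset.mem_range.1 hk)
      _ = A * (ρ + σ) ^ n + A * (ρ + σ) ^ n *
          ((1 + B / β - 1) * ∑ k ∈ Finset.range n, (1 + B / β) ^ k) := by
          rw [Finset.mul_sum, Finset.mul_sum]
          congr 1
          refine Finset.sum_congr rfl fun k hk => ?_
          rw [mul_pow, ← Nat.sub_add_cancel (Finset.mem_range.1 hk).le, pow_add,
            Nat.add_sub_cancel]
          ring
      _ = β * (A / β * ((ρ + σ) * (1 + B / β)) ^ n) := by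
          rw [mul_geom_sum, mul_pow]; field_simp; ring

/-- The series `t / (1 - t)`. -/
def mobius : ℂ⟦X⟧ := X * mk 1

theorem hasSubst_mobius : HasSubst mobius :=
  HasSubst.of_constantCoeff_zero' (by simp [mobius])

theorem coeff_mobius_pow (m k : ℕ) : coeff (m + 1) (mobius ^ (k + 1)) = (m.choose k : ℂ) := by
  rw [mobius, mul_pow, mk_one_pow_eq_mk_choose_add, coeff_X_pow_mul']
  split_ifs with h
  · rw [coeff_mk]; congr 2; omega
  · rw [Nat.choose_eq_zero_of_lt (by omega)]; simp

/-- On the coefficients, `g ↦ (t g)(t / (1 - t)) / t` is the binomial transform, that is, the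
multiplication of exponential generating functions by `exp t`. -/
theorem coeff_subst_mobius_X_mul (g : ℂ⟦X⟧) (m : ℕ) :
    coeff (m + 1) ((X * g).subst mobius) =
      ∑ k ∈ Finset.range (m + 1), (m.choose k : ℂ) * coeff k g := by
  rw [coeff_subst' hasSubst_mobius, finsum_eq_sum_of_support_subset (s := Finset.range (m + 2)),
    Finset.sum_range_succ']
  · simp [coeff_mobius_pow, mul_comm]
  · intro d hd
    by_contra h
    obtain ⟨k, rfl⟩ : ∃ k, d = k + 1 := ⟨d - 1, by simp at h; omega⟩
    refine hd ?_
    simp only [Finset.coe_range, Set.mem_Iio] at h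
    simp [coeff_mobius_pow, Nat.choose_eq_zero_of_lt (show m < k by omega)]

theorem constantCoeff_subst_mobius_X_mul (g : ℂ⟦X⟧) :
    constantCoeff ((X * g).subst mobius) = 0 := by
  have h : constantCoeff (mobius * g.subst mobius) = 0 := by simp [mobius]
  rwa [subst_mul hasSubst_mobius, subst_X hasSubst_mobius]

theorem IsConvergent.subst_mobius {f : ℂ⟦X⟧} (hf : IsConvergent f) :
    IsConvergent (f.subst mobius) := by
  have hX : ∀ g, IsConvergent g → IsConvergent ((X * g : ℂ⟦X⟧).subst mobius) := fun g hg => by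
    obtain ⟨C, ρ, hC, hρ, h⟩ := isConvergent_iff.1 hg
    refine isConvergent_iff.2 ⟨C, 1 + ρ, hC, by positivity, fun n => ?_⟩
    rcases n with _ | m
    · simp [constantCoeff_subst_mobius_X_mul, hC]
    · rw [coeff_subst_mobius_X_mul]
      calc _ ≤ ∑ k ∈ Finset.range (m + 1), (m.choose k : ℝ) * (C * ρ ^ k) := by
            refine (norm_sum_le _ _).trans (Finset.sum_le_sum fun k _ => ?_)
            rw [norm_mul, Complex.norm_natCast]
            gcongr
            exact h k
        _ = C * (1 + ρ) ^ m := by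
            rw [add_comm 1 ρ, add_pow, Finset.mul_sum]
            exact Finset.sum_congr rfl fun k _ => by ring
        _ ≤ C * (1 + ρ) ^ (m + 1) := by
            gcongr
            · linarith
            · omega
  have hs : f = C (constantCoeff f) + X * mk fun n => coeff (n + 1) f := by
    rw [add_comm, ← eq_X_mul_shift_add_const]
  have hshift : IsConvergent (mk fun n => coeff (n + 1) f) := by
    obtain ⟨C, ρ, hC, hρ, h⟩ := isConvergent_iff.1 hf
    refine isConvergent_iff.2 ⟨C * ρ, ρ, by positivity, hρ, fun n => ?_⟩
    rw [coeff_mk, mul_assoc, ← pow_succ']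
    exact h _
  rw [hs, subst_add hasSubst_mobius]
  refine IsConvergent.add ?_ (hX _ hshift)
  rw [subst_C]
  exact isConvergent_C _

end

/-! ### Meromorphic germs -/

section

open PowerSeries

theorem coe_mem_meromorphicGerms {f : ℂ⟦X⟧} (hf : IsConvergent f) :
    (f : ℂ⸨X⸩) ∈ meromorphicGerms :=
  Subfield.subset_closure ⟨f, hf, rfl⟩

theorem exists_eq_div_of_mem_meromorphicGerms {g : ℂ⸨X⸩} (hg : g ∈ meromorphicGerms) :
    ∃ a b : ℂ⟦X⟧, IsConvergent a ∧ IsConvergent b ∧ b ≠ 0 ∧ g = (a : ℂ⸨X⸩) / (b : ℂ⸨X⸩) := by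
  have key : {g : ℂ⸨X⸩ | ∃ f : ℂ⟦X⟧, IsConvergent f ∧ g = (f : ℂ⸨X⸩)} =
      (convergentSubring.map (HahnSeries.ofPowerSeries ℤ ℂ) : Set ℂ⸨X⸩) := by
    ext g
    simp only [Set.mem_ofPred_eq, Subring.coe_map, Set.mem_image, eq_comm]
    rfl
  rw [meromorphicGerms, key, Subfield.mem_closure_iff, Subring.closure_eq] at hg
  obtain ⟨_, ⟨a, ha, rfl⟩, _, ⟨b, hb, rfl⟩, rfl⟩ := hg
  by_cases h : b = 0
  · subst h
    exact ⟨0, 1, convergentSubring.zero_mem, convergentSubring.one_mem, one_ne_zero, by simp⟩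
  · exact ⟨a, b, ha, hb, h, rfl⟩

theorem isConvergent_of_coe_mem {f : ℂ⟦X⟧} (hf : (f : ℂ⸨X⸩) ∈ meromorphicGerms) :
    IsConvergent f := by
  obtain ⟨a, b, ha, hb, hb0, h⟩ := exists_eq_div_of_mem_meromorphicGerms hf
  have hb0' : (b : ℂ⸨X⸩) ≠ 0 := by
    rwa [Ne, map_eq_zero_iff _ HahnSeries.ofPowerSeries_injective]
  rw [eq_div_iff hb0', ← map_mul, HahnSeries.ofPowerSeries_injective.eq_iff] at h
  refine IsConvergent.of_mul_left hb0 hb ?_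
  rwa [mul_comm, h]

theorem C_mem_meromorphicGerms (a : ℂ) : (HahnSeries.C a : ℂ⸨X⸩) ∈ meromorphicGerms := by
  rw [← coe_C]
  exact coe_mem_meromorphicGerms (isConvergent_C a)

theorem single_mem_meromorphicGerms (k : ℤ) :
    (HahnSeries.single k 1 : ℂ⸨X⸩) ∈ meromorphicGerms := by
  rw [RatFunc.single_zpow, ← coe_X]
  exact zpow_mem (coe_mem_meromorphicGerms isConvergent_X) k

end

/-! ### Minimal algebraic relations -/

section

open MvPolynomial
open scoped MonomialOrder

/-- A graded monomial order on finitely many variables `X₀, …, Xₙ₋₁` for which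
`X₀ < X₁ < ⋯ < Xₙ₋₁`. -/
theorem exists_monomialOrder (n : ℕ) : ∃ m : MonomialOrder.{0, 0} (Fin n),
    (∀ i j : Fin n, i < j → Finsupp.single i 1 ≺[m] Finsupp.single j 1) ∧
    ∀ u v : Fin n →₀ ℕ, u ≼[m] v → u.degree ≤ v.degree := by
  let m : MonomialOrder (Fin n) := (MonomialOrder.degLex : MonomialOrder (Fin n)ᵒᵈ)
  refine ⟨m, fun i j hij => ?_, fun u v huv => ?_⟩
  · exact (MonomialOrder.degLex_single_lt_iff (σ := (Fin n)ᵒᵈ)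
      (a := OrderDual.toDual i) (b := OrderDual.toDual j)).2 hij
  · exact Finsupp.DegLex.monotone_degree (α := (Fin n)ᵒᵈ) huv

section Substitution

variable {σ K : Type*} [Field K] (m : MonomialOrder σ) {s : σ → MvPolynomial σ K}
  {a : σ → K}

theorem degree_prod_pow_of_degree_single (hs : ∀ i, m.degree (s i) = Finsupp.single i 1)
    (e : σ →₀ ℕ) : m.degree (e.prod fun i k => s i ^ k) = e := by
  have h0 : ∀ i, s i ≠ 0 := fun i h => by
    have := hs i
    rw [h, m.degree_zero] at this
    simpa using congrArg (fun f => f i) this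
  rw [Finsupp.prod, m.degree_prod fun i _ => pow_ne_zero _ (h0 i)]
  conv_rhs => rw [← Finsupp.sum_single e]
  refine Finset.sum_congr rfl fun i _ => ?_
  rw [m.degree_pow, hs i]; simp

theorem leadingCoeff_prod_pow (ha : ∀ i, m.leadingCoeff (s i) = a i) (h0 : ∀ i, a i ≠ 0)
    (e : σ →₀ ℕ) : m.leadingCoeff (e.prod fun i k => s i ^ k) = e.prod fun i k => a i ^ k := by
  rw [Finsupp.prod, m.leadingCoeff_prod_of_regular]
  · exact Finset.prod_congr rfl fun i _ => by rw [m.leadingCoeff_pow, ha i]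
  · intro i _
    rw [m.leadingCoeff_pow, ha i]
    exact (IsRegular.of_ne_zero (pow_ne_zero _ (h0 i)))

/-- A substitution `Xᵢ ↦ sᵢ` where `sᵢ` has leading monomial `Xᵢ` preserves leading monomials. -/
theorem degree_bind₁_of_degree_single (hs : ∀ i, m.degree (s i) = Finsupp.single i 1)
    (ha : ∀ i, m.leadingCoeff (s i) = a i) (h0 : ∀ i, a i ≠ 0) {p : MvPolynomial σ K} (hp : p ≠ 0) :
    m.degree (bind₁ s p) = m.degree p ∧
      m.leadingCoeff (bind₁ s p) = m.leadingCoeff p * (m.degree p).prod fun i k => a i ^ k := by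
  classical
  have hlc : m.leadingCoeff p ≠ 0 := m.leadingCoeff_ne_zero_iff.2 hp
  have hcoeff : ∀ d, m.degree p ≼[m] d → coeff d (bind₁ s p) =
      m.leadingCoeff p * coeff d ((m.degree p).prod fun i k => s i ^ k) := fun d hd => by
    rw [bind₁, aeval_def, eval₂_eq, coeff_sum, Finset.sum_eq_single (m.degree p)]
    · rw [algebraMap_eq, coeff_C_mul]; rfl
    · intro e he hne
      rw [algebraMap_eq, coeff_C_mul]
      have h1 : e ≺[m] m.degree p :=
        lt_of_le_of_ne (m.le_degree he) fun h => hne (m.toSyn.injective h)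
      have h2 := m.coeff_eq_zero_of_lt (f := e.prod fun i k => s i ^ k) (d := d) (by
        rw [degree_prod_pow_of_degree_single m hs]; exact h1.trans_le hd)
      rw [Finsupp.prod] at h2
      rw [h2, mul_zero]
    · intro h
      exact absurd (m.degree_mem_support hp) h
  have hlead : coeff (m.degree p) (bind₁ s p) =
      m.leadingCoeff p * (m.degree p).prod fun i k => a i ^ k := by
    rw [hcoeff _ le_rfl, ← leadingCoeff_prod_pow m ha h0, MonomialOrder.leadingCoeff,
      MonomialOrder.leadingCoeff, degree_prod_pow_of_degree_single m hs]
  have hne : coeff (m.degree p) (bind₁ s p) ≠ 0 := by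
    rw [hlead]
    exact mul_ne_zero hlc (Finset.prod_ne_zero_iff.2 fun i _ => pow_ne_zero _ (h0 i))
  have hdeg : m.degree (bind₁ s p) = m.degree p := by
    refine m.toSyn.injective (le_antisymm (m.degree_le_iff.2 fun d hd => ?_)
      (m.le_degree (mem_support_iff.2 hne)))
    by_contra h
    rw [not_le] at h
    rw [mem_support_iff, hcoeff d h.le, m.coeff_eq_zero_of_lt (d := d), mul_zero] at hd
    · exact hd rfl
    · rwa [degree_prod_pow_of_degree_single m hs]
  exact ⟨hdeg, by rw [MonomialOrder.leadingCoeff, hdeg, hlead]⟩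

theorem degree_leadingCoeff_of_lt {i : σ} {c : K} (hc : c ≠ 0) {q : MvPolynomial σ K}
    (hq : m.degree q ≺[m] Finsupp.single i 1) :
    m.degree (C c * X i + q) = Finsupp.single i 1 ∧ m.leadingCoeff (C c * X i + q) = c := by
  classical
  have h1 : m.degree (C c * X i : MvPolynomial σ K) = Finsupp.single i 1 := by
    rw [C_mul_X_eq_monomial, m.degree_monomial, if_neg hc]
  have h2 : m.leadingCoeff (C c * X i : MvPolynomial σ K) = c := by
    rw [C_mul_X_eq_monomial, m.leadingCoeff_monomial]
  exact ⟨by rw [m.degree_add_of_lt (by rwa [h1]), h1],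
    by rw [m.leadingCoeff_add_of_lt (by rwa [h1]), h2]⟩

theorem degree_map_injective {K' : Type*} [Field K'] (φ : K →+* K') (p : MvPolynomial σ K) :
    m.degree (map φ p) = m.degree p := by
  rw [MonomialOrder.degree, MonomialOrder.degree, support_map_of_injective _ φ.injective]

theorem pderiv_bind₁ [Fintype σ] (s : σ → MvPolynomial σ K) (j : σ) (p : MvPolynomial σ K) :
    pderiv j (bind₁ s p) = ∑ i, bind₁ s (pderiv i p) * pderiv j (s i) := by
  classical
  induction p using MvPolynomial.induction_on with
  | C c => simp
  | add p q hp hq => simp only [map_add, hp, hq, add_mul, Finset.sum_add_distrib]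
  | mul_X p k hp =>
    have : ∀ i, bind₁ s (pderiv i (p * X k)) * pderiv j (s i) =
        (if i = k then bind₁ s p * pderiv j (s i) else 0) +
          s k * (bind₁ s (pderiv i p) * pderiv j (s i)) := fun i => by
      rw [Derivation.leibniz, pderiv_X, Pi.single_apply]
      simp only [smul_eq_mul, map_add, map_mul, bind₁_X_right]
      split_ifs <;> simp_all <;> ring
    rw [map_mul, bind₁_X_right, Derivation.leibniz, hp, Finset.sum_congr rfl fun i _ => this i,
      Finset.sum_add_distrib, Finset.sum_ite_eq', if_pos (Finset.mem_univ _), ← Finset.mul_sum]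
    simp [smul_eq_mul]

theorem eq_C_of_pderiv_eq_zero [CharZero K] {p : MvPolynomial σ K} (h : ∀ j, pderiv j p = 0) :
    p = C (coeff 0 p) := by
  classical
  ext e
  rw [coeff_C]
  split_ifs with he
  · rw [he]
  · obtain ⟨j, hj⟩ : ∃ j, e j ≠ 0 := by
      by_contra! h'
      exact he (Finsupp.ext fun j => by simp [h' j])
    have h1 := congrArg (coeff (e - Finsupp.single j 1)) (h j)
    have h2 : Finsupp.single j 1 ≤ e := by
      rw [Finsupp.single_le_iff]; omega
    rw [coeff_pderiv, tsub_add_cancel_of_le h2, coeff_zero, mul_eq_zero] at h1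
    refine h1.resolve_right ?_
    exact Nat.cast_add_one_ne_zero _

end Substitution

section Relation

variable {σ K L : Type*} [Field K] [Field L] [Algebra K L] {m : MonomialOrder σ}
  {y : σ → L} {P : MvPolynomial σ K}

/-- `P` is a monic polynomial relation of smallest possible leading monomial between the `y i`. -/
structure IsMinimalRelation (m : MonomialOrder σ) (y : σ → L) (P : MvPolynomial σ K) : Prop where
  monic : m.Monic P
  aeval_eq_zero : aeval y P = 0
  eq_zero_of_lt : ∀ Q : MvPolynomial σ K, aeval y Q = 0 → m.degree Q ≺[m] m.degree P → Q = 0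

theorem exists_isMinimalRelation (m : MonomialOrder σ) (hP : P ≠ 0) (hy : aeval y P = 0) :
    ∃ P : MvPolynomial σ K, IsMinimalRelation m y P := by
  let S : Set m.syn := {d | ∃ Q : MvPolynomial σ K, Q ≠ 0 ∧ aeval y Q = 0 ∧ m.toSyn (m.degree Q) = d}
  have hS : S.Nonempty := ⟨_, P, hP, hy, rfl⟩
  obtain ⟨Q, hQ, hQy, hd⟩ := wellFounded_lt.min_mem S hS
  have hlc : m.leadingCoeff Q ≠ 0 := m.leadingCoeff_ne_zero_iff.2 hQ
  have hdeg : m.degree (C (m.leadingCoeff Q)⁻¹ * Q) = m.degree Q := by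
    rw [m.degree_mul (by simpa using hQ) hQ, m.degree_C, zero_add]
  refine ⟨C (m.leadingCoeff Q)⁻¹ * Q, ?_, by simp [hQy], fun R hR hlt => ?_⟩
  · rw [MonomialOrder.Monic, m.leadingCoeff_mul, m.leadingCoeff_C, inv_mul_cancel₀ hlc]
  · by_contra hR0
    rw [hdeg, hd] at hlt
    exact wellFounded_lt.not_lt_min S ⟨R, hR0, hR, rfl⟩ hlt

namespace IsMinimalRelation

theorem degree_ne_zero (hP : IsMinimalRelation m y P) : m.degree P ≠ 0 := fun h => by
  have h1 := m.eq_C_of_degree_eq_zero h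
  rw [hP.monic.leadingCoeff_eq_one] at h1
  have := hP.aeval_eq_zero
  rw [h1] at this
  simp at this

theorem pos_degree (hP : IsMinimalRelation m y P) : 0 ≺[m] m.degree P :=
  lt_of_le_of_ne (by simp) fun h => hP.degree_ne_zero (m.toSyn.injective h).symm

theorem add_single_le_of_mem_support_pderiv {P : MvPolynomial σ K} {j : σ} {e : σ →₀ ℕ}
    (he : e ∈ (pderiv j P).support) : e + Finsupp.single j 1 ≼[m] m.degree P := by
  rw [mem_support_iff, coeff_pderiv] at he
  exact m.le_degree (mem_support_iff.2 (left_ne_zero_of_mul he))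

theorem pderiv_eq_C (hP : IsMinimalRelation m y P) {j : σ} {c : K}
    (h : aeval y (pderiv j P) = algebraMap K L c) : pderiv j P = C c := by
  classical
  rw [← sub_eq_zero]
  refine hP.eq_zero_of_lt _ (by simp [h]) ((m.degree_lt_iff hP.pos_degree).2 fun e he => ?_)
  rcases Finset.mem_union.1 (support_sub _ _ _ he) with he | he
  · refine lt_of_lt_of_le ?_ (add_single_le_of_mem_support_pderiv he)
    rw [map_add]
    refine lt_add_of_pos_right _ (lt_of_le_of_ne (by simp) fun h0 => ?_)
    rw [← map_zero m.toSyn, m.toSyn.injective.eq_iff] at h0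
    simpa using congrArg (fun f => f j) h0
  · rw [mem_support_iff, coeff_C] at he
    have : e = 0 := by
      by_contra hne
      exact he (if_neg fun h => hne h.symm)
    rw [this]
    exact hP.pos_degree

/-- If all partial derivatives of a minimal relation are constants, the relation is linear. -/
theorem exists_linear [Fintype σ] [CharZero K] (hP : IsMinimalRelation m y P) {c : σ → K}
    (h : ∀ j, pderiv j P = C (c j)) :
    c ≠ 0 ∧ ∃ k : K, ∑ j, algebraMap K L (c j) * y j = algebraMap K L k := by
  classical
  have h1 : ∀ j, pderiv j (P - ∑ i, C (c i) * X i) = 0 := fun j => by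
    simp [h j, pderiv_X, Pi.single_apply]
  have h2 := eq_C_of_pderiv_eq_zero h1
  refine ⟨fun hc => hP.degree_ne_zero ?_, -coeff 0 (P - ∑ i, C (c i) * X i), ?_⟩
  · rw [hc] at h2
    simp only [Pi.zero_apply, map_zero, zero_mul, Finset.sum_const_zero, sub_zero] at h2
    rw [h2, m.degree_C]
  · have h3 := congrArg (aeval y) h2
    rw [map_sub, hP.aeval_eq_zero] at h3
    simp only [map_sum, map_mul, aeval_C, aeval_X] at h3
    rw [map_neg, ← h3]
    ring

variable {τ : L →+* L} {φ : K →+* K} {a : K} {N : σ → σ → K} {b : σ → K}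

/-- Let `τ` be an endomorphism of `L` acting on the `y i` by a triangular affine substitution with
constant diagonal `a`. The transform of a minimal relation by `τ` is proportional to it, which gives
linear `τ`-equations for the values at `y` of its partial derivatives. -/
theorem tau_aeval_pderiv [Fintype σ] (hP : IsMinimalRelation m y P)
    (hφ : ∀ k, τ (algebraMap K L k) = algebraMap K L (φ k)) (ha : a ≠ 0)
    (hN : ∀ i j, N i j ≠ 0 → Finsupp.single j 1 ≺[m] Finsupp.single i 1)
    (hy : ∀ i, τ (y i) = algebraMap K L a * y i + ∑ j, algebraMap K L (N i j) * y j +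
      algebraMap K L (b i)) (j : σ) :
    algebraMap K L a * τ (aeval y (pderiv j P)) +
        ∑ i, algebraMap K L (N i j) * τ (aeval y (pderiv i P)) =
      algebraMap K L a ^ (m.degree P).degree * aeval y (pderiv j P) := by
  classical
  let s : σ → MvPolynomial σ K := fun i => C a * X i + (∑ j, C (N i j) * X j + C (b i))
  have hs : ∀ i, m.degree (s i) = Finsupp.single i 1 ∧ m.leadingCoeff (s i) = a := fun i => by
    have hpos : (0 : σ →₀ ℕ) ≺[m] Finsupp.single i 1 :=
      lt_of_le_of_ne (by simp) fun h => by
        simpa using congrArg (fun f => f i) (m.toSyn.injective h)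
    refine degree_leadingCoeff_of_lt m ha (lt_of_le_of_lt m.degree_add_le (max_lt ?_ ?_))
    · refine lt_of_le_of_lt m.degree_sum_le ((Finset.sup_lt_iff ?_).2 fun j _ => ?_)
      · rw [m.bot_eq_zero]; simpa using hpos
      · by_cases h : N i j = 0
        · simpa [h] using hpos
        · rw [C_mul_X_eq_monomial, m.degree_monomial, if_neg h]
          exact hN i j h
    · rw [m.degree_C]; exact hpos
  have hsy : ∀ i, aeval y (s i) = τ (y i) := fun i => by
    rw [hy]; simp [s, add_assoc]
  have hτ : ∀ Q : MvPolynomial σ K, aeval y (bind₁ s (map φ Q)) = τ (aeval y Q) := fun Q => by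
    induction Q using MvPolynomial.induction_on with
    | C c => simp [hφ]
    | add p q hp hq => simp only [map_add, hp, hq]
    | mul_X p k hp => simp only [map_mul, hp, map_X, bind₁_X_right, hsy, aeval_X]
  set μ := a ^ (m.degree P).degree with hμ
  have hP0 : P ≠ 0 := hP.monic.ne_zero
  have hmap0 : map φ P ≠ 0 := by
    rwa [Ne, map_eq_zero_iff _ (map_injective _ φ.injective)]
  obtain ⟨hd, hl⟩ := degree_bind₁_of_degree_single m (fun i => (hs i).1) (fun i => (hs i).2)
    (fun _ => ha) hmap0
  have hl' : m.leadingCoeff (bind₁ s (map φ P)) = μ := by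
    rw [hl, MonomialOrder.leadingCoeff, degree_map_injective, coeff_map, hP.monic.coeff_degree,
      map_one, one_mul, hμ, Finsupp.degree, Finsupp.prod, Finset.prod_pow_eq_pow_sum]
    rfl
  rw [degree_map_injective] at hd
  -- The difference has a smaller leading monomial and vanishes at `y`, so it is zero.
  have key : bind₁ s (map φ P) = C μ * P := by
    rw [← sub_eq_zero]
    refine hP.eq_zero_of_lt _ (by rw [map_sub, hτ, map_mul, hP.aeval_eq_zero]; simp) ?_
    refine (m.degree_lt_iff hP.pos_degree).2 fun e he => ?_
    rw [mem_support_iff, coeff_sub, coeff_C_mul] at he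
    by_contra hlt
    rw [not_lt] at hlt
    rcases hlt.eq_or_lt with h | h
    · have h := m.toSyn.injective h
      subst h
      rw [hP.monic.coeff_degree, ← hl', MonomialOrder.leadingCoeff, hd, mul_one, sub_self] at he
      exact he rfl
    · rw [m.coeff_eq_zero_of_lt (by rwa [hd]), m.coeff_eq_zero_of_lt h] at he
      simp at he
  have h1 := congrArg (fun Q => aeval y (pderiv j Q)) key
  simp only [pderiv_bind₁, map_sum, map_mul, pderiv_map, hτ, Derivation.leibniz, pderiv_C,
    smul_eq_mul] at h1
  rw [mul_zero, add_zero, map_mul, aeval_C, hμ, map_pow] at h1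
  rw [← h1]
  have h2 : ∀ i, aeval y (pderiv j (s i)) =
      (if i = j then algebraMap K L a else 0) + algebraMap K L (N i j) := fun i => by
    simp [s, pderiv_X, Pi.single_apply, apply_ite (aeval y)]
  simp only [h2, mul_add, Finset.sum_add_distrib]
  simp [mul_comm]

end IsMinimalRelation

end Relation

end

/-! ### The endomorphism `g(t) ↦ g(t / (1 - t))` -/

section

open PowerSeries

theorem subst_mobius_eq (f : ℂ⟦X⟧) : f.subst mobius =
    (X * mk fun n => coeff (n + 1) f : ℂ⟦X⟧).subst mobius + C (constantCoeff f) := by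
  conv_lhs => rw [eq_X_mul_shift_add_const f, subst_add hasSubst_mobius, subst_C]
  rfl

theorem constantCoeff_subst_mobius (f : ℂ⟦X⟧) :
    constantCoeff (f.subst mobius) = constantCoeff f := by
  rw [subst_mobius_eq, map_add, constantCoeff_subst_mobius_X_mul]; simp

theorem coeff_one_subst_mobius (f : ℂ⟦X⟧) : coeff 1 (f.subst mobius) = coeff 1 f := by
  rw [subst_mobius_eq, map_add, ← zero_add 1, coeff_subst_mobius_X_mul]; simp

theorem subst_mobius_injective :
    Function.Injective (substAlgHom (R := ℂ) hasSubst_mobius : ℂ⟦X⟧ →ₐ[ℂ] ℂ⟦X⟧) := by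
  rw [injective_iff_map_eq_zero]
  intro f hf
  by_contra h
  rw [← X_pow_order_mul_divXPowOrder (f := f), map_mul, map_pow, mul_eq_zero,
    substAlgHom_X] at hf
  rcases hf with hf | hf
  · refine pow_ne_zero _ (fun h0 => ?_) hf
    have := coeff_mobius_pow 0 0
    simp [h0] at this
  · rw [coe_substAlgHom] at hf
    have := constantCoeff_subst_mobius f.divXPowOrder
    rw [hf, map_zero, eq_comm, constantCoeff_divXPowOrder_eq_zero_iff] at this
    exact h this

/-- The endomorphism `g(t) ↦ g(t / (1 - t))` of `ℂ((t))`. -/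
def tau : ℂ⸨X⸩ →+* ℂ⸨X⸩ :=
  IsFractionRing.lift (A := ℂ⟦X⟧) (g := (HahnSeries.ofPowerSeries ℤ ℂ).comp
    (substAlgHom (R := ℂ) hasSubst_mobius : ℂ⟦X⟧ →ₐ[ℂ] ℂ⟦X⟧).toRingHom)
    (HahnSeries.ofPowerSeries_injective.comp subst_mobius_injective)

theorem tau_coe (f : ℂ⟦X⟧) : tau (f : ℂ⸨X⸩) = ((f.subst mobius : ℂ⟦X⟧) : ℂ⸨X⸩) := by
  have := IsFractionRing.lift_algebraMap (K := ℂ⸨X⸩) (A := ℂ⟦X⟧) (g := (HahnSeries.ofPowerSeries ℤ ℂ).comp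
    (substAlgHom (R := ℂ) hasSubst_mobius : ℂ⟦X⟧ →ₐ[ℂ] ℂ⟦X⟧).toRingHom)
    (HahnSeries.ofPowerSeries_injective.comp subst_mobius_injective) f
  rw [← coe_substAlgHom hasSubst_mobius]
  exact this

theorem tau_C (a : ℂ) : tau (HahnSeries.C a) = HahnSeries.C a := by
  rw [← coe_C, tau_coe, subst_C]
  rfl

theorem tau_mem {g : ℂ⸨X⸩} (hg : g ∈ meromorphicGerms) : tau g ∈ meromorphicGerms := by
  obtain ⟨a, b, ha, hb, -, rfl⟩ := exists_eq_div_of_mem_meromorphicGerms hg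
  rw [map_div₀, tau_coe, tau_coe]
  exact div_mem (coe_mem_meromorphicGerms ha.subst_mobius)
    (coe_mem_meromorphicGerms hb.subst_mobius)

/-- The restriction of `tau` to the meromorphic germs. -/
def tauGerm : meromorphicGerms →+* meromorphicGerms :=
  (tau.comp meromorphicGerms.subtype).codRestrict meromorphicGerms fun g => tau_mem g.2

/-- The power series `(1 - t)⁻ᵏ = 1 + k t + ⋯`. -/
theorem exists_zpow_eq_coe (k : ℤ) : ∃ v : ℂ⟦X⟧, constantCoeff v = 1 ∧ coeff 1 v = k ∧
    ((mk 1 : ℂ⟦X⟧) : ℂ⸨X⸩) ^ k = (v : ℂ⸨X⸩) := by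
  obtain ⟨n, rfl | rfl⟩ := k.eq_nat_or_neg
  · refine ⟨mk 1 ^ n, ?_, ?_, by simp⟩ <;>
      simp [coeff_one_pow, constantCoeff_mk]
  · refine ⟨(1 - X) ^ n, by simp, by simp [coeff_one_pow, coeff_one], ?_⟩
    have h : ((mk 1 : ℂ⟦X⟧) : ℂ⸨X⸩) * ((1 - X : ℂ⟦X⟧) : ℂ⸨X⸩) = 1 := by
      rw [← map_mul, mk_one_mul_one_sub_eq_one, map_one]
    rw [zpow_neg, zpow_natCast, map_pow, ← inv_pow, inv_eq_of_mul_eq_one_right h]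

/-- The first two coefficients of `g(t / (1 - t))`, when `g` has no term of degree less than `k`. -/
theorem coeff_tau {z : ℂ⸨X⸩} {k : ℤ} (hz : ∀ i < k, z.coeff i = 0) :
    (∀ i < k, (tau z).coeff i = 0) ∧ (tau z).coeff k = z.coeff k ∧
      (tau z).coeff (k + 1) = z.coeff (k + 1) + k * z.coeff k := by
  set u : ℂ⟦X⟧ := mk fun n => z.coeff (k + n) with hu
  have hzu : z = HahnSeries.single k 1 * (u : ℂ⸨X⸩) := by
    ext i
    obtain ⟨j, rfl⟩ : ∃ j, i = k + j := ⟨i - k, by ring⟩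
    rw [add_comm k j, HahnSeries.coeff_single_mul_add, one_mul, PowerSeries.coeff_coe]
    split_ifs with h
    · exact hz _ (by omega)
    · rw [hu, coeff_mk]; congr 1; omega
  obtain ⟨v, hv0, hv1, hv⟩ := exists_zpow_eq_coe k
  have hτ : tau z = HahnSeries.single k 1 * ((v * u.subst mobius : ℂ⟦X⟧) : ℂ⸨X⸩) := by
    rw [hzu, map_mul, tau_coe, RatFunc.single_zpow, ← coe_X, map_zpow₀, tau_coe,
      subst_X hasSubst_mobius, mobius, map_mul, mul_zpow, hv, map_mul, mul_assoc]
  have hc : ∀ j : ℤ, (tau z).coeff (k + j) =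
      if j < 0 then 0 else coeff j.natAbs (v * u.subst mobius) := fun j => by
    rw [hτ, add_comm k j, HahnSeries.coeff_single_mul_add, one_mul, PowerSeries.coeff_coe]
  have hu0 : constantCoeff u = z.coeff k := by simp [hu, ← coeff_zero_eq_constantCoeff_apply]
  have hu1 : coeff 1 u = z.coeff (k + 1) := by simp [hu]
  refine ⟨fun i hi => ?_, ?_, ?_⟩
  · have := hc (i - k)
    rwa [if_pos (by omega), add_sub_cancel] at this
  · have := hc 0
    simpa [hv0, constantCoeff_subst_mobius, hu0] using this
  · have := hc 1
    rw [this]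
    simp [coeff_one_mul, hv0, hv1, constantCoeff_subst_mobius, coeff_one_subst_mobius, hu0, hu1]
    ring

theorem order_tau (z : ℂ⸨X⸩) : (tau z).order = z.order := by
  rcases eq_or_ne z 0 with rfl | hz
  · simp
  have hc := coeff_tau (z := z) (k := z.order) fun i hi => HahnSeries.coeff_eq_zero_of_lt_order hi
  have h0 : (tau z).coeff z.order ≠ 0 := by
    rwa [hc.2.1, Ne, HahnSeries.coeff_order_eq_zero]
  refine le_antisymm (HahnSeries.order_le_of_coeff_ne_zero h0) ?_
  by_contra! h
  exact (map_ne_zero tau).2 hz (HahnSeries.coeff_order_eq_zero.1 (hc.1 _ h))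

/-- The eigenvectors of `tau` for constant eigenvalues are constants. -/
theorem eq_C_of_tau_eq {z : ℂ⸨X⸩} {μ : ℂ} (h : tau z = HahnSeries.C μ * z) :
    ∃ c : ℂ, z = HahnSeries.C c := by
  have key : ∀ {z : ℂ⸨X⸩}, z ≠ 0 → tau z = HahnSeries.C μ * z → μ = 1 ∧ z.order = 0 := by
    intro z hz h
    have hc := coeff_tau (z := z) (k := z.order) fun i hi =>
      HahnSeries.coeff_eq_zero_of_lt_order hi
    have h0 : z.coeff z.order ≠ 0 := by rwa [Ne, HahnSeries.coeff_order_eq_zero]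
    rw [h] at hc
    simp only [HahnSeries.C_mul_eq_smul, HahnSeries.coeff_smul, smul_eq_mul] at hc
    have hμ : μ = 1 := mul_right_cancel₀ h0 (by rw [hc.2.1, one_mul])
    refine ⟨hμ, ?_⟩
    have h1 := hc.2.2
    rw [hμ, one_mul, left_eq_add, mul_eq_zero] at h1
    exact_mod_cast h1.resolve_right h0
  by_cases hz : z = 0
  · exact ⟨0, by simp [hz]⟩
  obtain ⟨rfl, h0⟩ := key hz h
  refine ⟨z.coeff 0, ?_⟩
  by_contra hne
  rw [← sub_eq_zero] at hne
  have h2 := (key hne (by rw [map_sub, tau_C, h]; simp)).2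
  apply hne
  rw [← HahnSeries.coeff_order_eq_zero, h2]
  simp

/-- As `tau` preserves orders, `tau z = aᵏ z` has no non-zero solution if `a` has a pole. -/
theorem eq_zero_of_tau_eq {z a : ℂ⸨X⸩} (ha : a.order < 0) {k : ℕ} (hk : k ≠ 0)
    (h : tau z = a ^ k * z) : z = 0 := by
  by_contra hz
  have ha0 : a ≠ 0 := fun h0 => by simp [h0] at ha
  have := order_tau z
  rw [h, HahnSeries.order_mul (pow_ne_zero _ ha0) hz, HahnSeries.order_pow, add_eq_right,
    smul_eq_zero] at this
  exact this.elim hk ha.ne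

/-- The equation `g(t / (1 - t)) - g(t) = w` has no solution if `w` has order `1`: a term of lowest
degree `k ≠ 0` in `g` yields a term of degree `k + 1`, and a constant one yields nothing. -/
theorem tau_sub_ne {z w : ℂ⸨X⸩} (hw : w.order = 1) : tau z - z ≠ w := by
  rintro rfl
  set w := tau z - z with hwz
  have hw0 : w ≠ 0 := fun h => by simp [h] at hw
  have hw1 : w.coeff 1 ≠ 0 := by rwa [← hw, Ne, HahnSeries.coeff_order_eq_zero]
  have hz : z ≠ 0 := fun h => hw0 (by simp [hwz, h])
  have hc := (coeff_tau (z := z) (k := z.order) fun i hi =>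
    HahnSeries.coeff_eq_zero_of_lt_order hi).2.2
  have h1 : w.coeff (z.order + 1) = z.order * z.coeff z.order := by
    rw [hwz, HahnSeries.coeff_sub, hc]; ring
  by_cases h0 : z.order = 0
  · rw [h0] at h1
    simp at h1
    exact hw1 h1
  · have h2 : w.coeff (z.order + 1) ≠ 0 := by
      rw [h1]
      exact mul_ne_zero (by exact_mod_cast h0) (by rwa [Ne, HahnSeries.coeff_order_eq_zero])
    have h3 := HahnSeries.order_le_of_coeff_ne_zero h2
    rw [hw] at h3
    have h4 := (coeff_tau (z := z) (k := 1) fun i hi =>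
      HahnSeries.coeff_eq_zero_of_lt_order (by omega)).2.1
    exact hw1 (by rw [hwz, HahnSeries.coeff_sub, h4, sub_self])

end

/-! ### The formal Laplace transform -/

section

open PowerSeries

/-- The formal Laplace transform `∑ aₙ tⁿ / n! ↦ ∑ aₙ tⁿ`. -/
def lap : ℂ⟦X⟧ →ₗ[ℂ] ℂ⟦X⟧ where
  toFun f := mk fun n => (n.factorial : ℂ) * coeff n f
  map_add' f g := by ext n; simp [mul_add]
  map_smul' c f := by ext n; simp; ring

theorem coeff_lap (f : ℂ⟦X⟧) (n : ℕ) : coeff n (lap f) = (n.factorial : ℂ) * coeff n f := by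
  simp [lap]

/-- The substitution `t ↦ t / (1 - t)` corresponds to the multiplication by `exp t` under the
Laplace transform. -/
theorem tau_X_mul_lap (f : ℂ⟦X⟧) : tau ((X * lap f : ℂ⟦X⟧) : ℂ⸨X⸩) =
    ((X * lap (exp ℂ * f) : ℂ⟦X⟧) : ℂ⸨X⸩) := by
  rw [tau_coe]
  congr 1
  ext n
  rcases n with _ | m
  · rw [coeff_zero_eq_constantCoeff_apply, constantCoeff_subst_mobius_X_mul]; simp
  · rw [coeff_subst_mobius_X_mul, coeff_succ_X_mul, coeff_lap, mul_comm (exp ℂ), coeff_mul,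
      Finset.Nat.sum_antidiagonal_eq_sum_range_succ_mk, Finset.mul_sum]
    refine Finset.sum_congr rfl fun k hk => ?_
    have hk : k ≤ m := by simpa [Nat.lt_succ_iff] using hk
    rw [coeff_lap, coeff_exp, Nat.cast_choose ℂ hk]
    have := Nat.cast_ne_zero (R := ℂ).2 k.factorial_ne_zero
    have := Nat.cast_ne_zero (R := ℂ).2 (m - k).factorial_ne_zero
    simp
    field_simp

theorem X_mul_lap_derivative (f : ℂ⟦X⟧) :
    X * lap (d⁄dX ℂ f) = lap f - C (constantCoeff f) := by
  ext n
  rcases n with _ | n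
  · rw [map_sub, coeff_lap]; simp
  · rw [coeff_succ_X_mul, coeff_lap, coeff_derivative, map_sub, coeff_lap, coeff_C,
      if_neg n.succ_ne_zero, Nat.factorial_succ]
    push_cast; ring

/-- The series `t · lap (tⁱ f)`. It is the image of `t · lap f` by the `i`-th power of the
derivation `t² d/dt`, which commutes with `tau`. -/
def lapSeq (f : ℂ⟦X⟧) (i : ℕ) : ℂ⸨X⸩ := ((X * lap (X ^ i * f) : ℂ⟦X⟧) : ℂ⸨X⸩)

theorem coeff_lapSeq_succ (f : ℂ⟦X⟧) (i : ℕ) (k : ℤ) :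
    (lapSeq f (i + 1)).coeff (k + 1) = k * (lapSeq f i).coeff k := by
  rw [lapSeq, lapSeq, coeff_coe, coeff_coe]
  rcases lt_trichotomy k 0 with hk | rfl | hk
  · rcases eq_or_lt_of_le (show k + 1 ≤ 0 by omega) with h | h
    · simp [h, hk]
    · simp [h, hk]
  · simp [pow_succ', mul_assoc, coeff_lap]
  · lift k to ℕ using hk.le
    obtain ⟨m, rfl⟩ : ∃ m, k = m + 1 := ⟨k - 1, by omega⟩
    rw [if_neg (by omega), if_neg (by omega), show ((↑(m + 1) : ℤ) + 1).natAbs = m + 1 + 1 by omega,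
      Int.natAbs_natCast, coeff_succ_X_mul, coeff_succ_X_mul, coeff_lap, coeff_lap, pow_succ',
      mul_assoc, coeff_succ_X_mul, Nat.factorial_succ]
    push_cast; ring

theorem derivative_single_mul_lapSeq (f : ℂ⟦X⟧) (i : ℕ) (r : ℤ) :
    LaurentSeries.derivative ℂ (HahnSeries.single r 1 * lapSeq f i) =
      HahnSeries.C (r : ℂ) * (HahnSeries.single (r - 1) 1 * lapSeq f i) +
        HahnSeries.single (r - 2) 1 * lapSeq f (i + 1) := by
  ext k
  rw [LaurentSeries.derivative_apply, LaurentSeries.hasseDeriv_coeff, HahnSeries.coeff_add,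
    HahnSeries.C_mul_eq_smul, HahnSeries.coeff_smul]
  have h1 := HahnSeries.coeff_single_mul_add (r := (1 : ℂ)) (x := lapSeq f i) (a := k + 1 - r) (b := r)
  have h2 := HahnSeries.coeff_single_mul_add (r := (1 : ℂ)) (x := lapSeq f i) (a := k + 1 - r) (b := r - 1)
  have h3 := HahnSeries.coeff_single_mul_add (r := (1 : ℂ)) (x := lapSeq f (i + 1)) (a := k + 1 - r + 1) (b := r - 2)
  rw [coeff_lapSeq_succ] at h3
  ring_nf at h1 h2 h3 ⊢
  simp [h1, h2, h3]
  ring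

/-- The `i`-th derivative of `lap f` is a combination of the series `lapSeq f j`, `j ≤ i`, with an
invertible coefficient for `j = i`. -/
theorem derivative_iterate_lap (f : ℂ⟦X⟧) (i : ℕ) : ∃ c : ℕ → ℂ, c i = 1 ∧
    (LaurentSeries.derivative ℂ)^[i] (lap f : ℂ⸨X⸩) = ∑ j ∈ Finset.range (i + 1),
      HahnSeries.C (c j) * (HahnSeries.single (-(i + j + 1) : ℤ) 1 * lapSeq f j) := by
  induction i with
  | zero =>
    refine ⟨1, rfl, ?_⟩
    simp [lapSeq, ← mul_assoc]
  | succ i ih =>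
    obtain ⟨c, hc, h⟩ := ih
    refine ⟨fun j => (if j ≤ i then c j * (-(i + j + 1) : ℤ) else 0) +
      (if j = 0 then 0 else c (j - 1)), by simp [hc], ?_⟩
    rw [Function.iterate_succ_apply', h, map_sum]
    simp only [HahnSeries.C_mul_eq_smul, map_smul, derivative_single_mul_lapSeq, smul_add]
    rw [Finset.sum_add_distrib]
    simp only [add_smul, Finset.sum_add_distrib]
    congr 1
    · rw [Finset.sum_range_succ _ (i + 1)]
      simp only [show ¬ (i + 1 ≤ i) by omega, if_false, zero_smul, add_zero]
      refine Finset.sum_congr rfl fun j hj => ?_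
      rw [if_pos (by simpa [Nat.lt_succ_iff] using hj), smul_smul]
      congr 3
      push_cast; ring_nf
    · rw [Finset.sum_range_succ' _ (i + 1)]
      simp only [if_true, zero_smul, add_zero]
      refine Finset.sum_congr rfl fun j hj => ?_
      simp only [Nat.add_sub_cancel, Nat.succ_ne_zero, if_false]
      congr 3
      push_cast; ring_nf

/-- The derivatives of `lap f` are related to the series `lapSeq f i` by an invertible triangular
linear substitution, so the former are algebraically independent if the latter are. -/
theorem isDifferentiallyTranscendental_lap {f : ℂ⟦X⟧}
    (h : ∀ (n : ℕ) (P : MvPolynomial (Fin n) meromorphicGerms),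
      MvPolynomial.aeval (fun i : Fin n => lapSeq f i) P = 0 → P = 0) :
    IsDifferentiallyTranscendental (lap f : ℂ⸨X⸩) := by
  classical
  intro n P hP h0
  obtain ⟨m, hm, -⟩ := exists_monomialOrder (n + 1)
  choose c hc hcd using derivative_iterate_lap f
  let k : ℕ → ℕ → meromorphicGerms := fun i j =>
    ⟨HahnSeries.C (c i j) * HahnSeries.single (-(i + j + 1) : ℤ) 1,
      mul_mem (C_mem_meromorphicGerms _) (single_mem_meromorphicGerms _)⟩
  have hka : ∀ i j, algebraMap meromorphicGerms ℂ⸨X⸩ (k i j) =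
      HahnSeries.C (c i j) * HahnSeries.single (-(i + j + 1) : ℤ) 1 := fun i j => rfl
  have hk : ∀ i, k i i ≠ 0 := fun i hi => by
    have := congrArg Subtype.val hi
    simp [k, hc] at this
  let s : Fin (n + 1) → MvPolynomial (Fin (n + 1)) meromorphicGerms := fun i =>
    MvPolynomial.C (k i i) * MvPolynomial.X i +
      ∑ j : Fin i, MvPolynomial.C (k i j) * MvPolynomial.X (Fin.castLE i.2.le j)
  have hs : ∀ i, m.degree (s i) = Finsupp.single i 1 ∧ m.leadingCoeff (s i) = k i i := fun i => by
    refine degree_leadingCoeff_of_lt m (hk i) (lt_of_le_of_lt m.degree_sum_le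
      ((Finset.sup_lt_iff ?_).2 fun j hj => ?_))
    · rw [m.bot_eq_zero]
      exact lt_of_le_of_ne (by simp) fun h => by
        simpa using congrArg (fun f => f i) (m.toSyn.injective ((map_zero m.toSyn).trans h))
    · rw [MvPolynomial.C_mul_X_eq_monomial]
      exact (m.degree_monomial_le _).trans_lt (hm _ i j.2)
  have hsy : ∀ i, MvPolynomial.aeval (fun i : Fin (n + 1) => lapSeq f i) (s i) =
      (LaurentSeries.derivative ℂ)^[(i : ℕ)] (lap f : ℂ⸨X⸩) := fun i => by
    rw [hcd, Finset.sum_range_succ, add_comm (Finset.sum _ _)]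
    simp only [s, map_add, map_sum, map_mul, MvPolynomial.aeval_C, MvPolynomial.aeval_X, hka,
      mul_assoc, Finset.sum_range, Fin.val_castLE]
  have h1 := h (n + 1) (MvPolynomial.bind₁ s P) (by
    rw [MvPolynomial.aeval_bind₁]
    simpa only [hsy] using h0)
  have h2 := (degree_bind₁_of_degree_single m (fun i => (hs i).1) (fun i => (hs i).2)
    (fun i => hk i) hP).2
  rw [h1, m.leadingCoeff_zero, eq_comm, mul_eq_zero, m.leadingCoeff_eq_zero_iff] at h2
  exact h2.elim hP (Finset.prod_ne_zero_iff.2 fun i _ => pow_ne_zero _ (hk i))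

end

/-! ### Difference equations and minimal relations -/

section

open PowerSeries

theorem isConvergent_of_X_mul {g : ℂ⟦X⟧} (h : ((X * g : ℂ⟦X⟧) : ℂ⸨X⸩) ∈ meromorphicGerms) :
    IsConvergent g :=
  IsConvergent.of_X_pow_mul (N := 1) (by rw [pow_one]; exact isConvergent_of_coe_mem h)

instance : CharZero meromorphicGerms where
  cast_injective a b h := by
    have h1 : ((a : ℂ⸨X⸩)) = b := by simpa using congrArg (Subtype.val) h
    rw [← map_natCast (HahnSeries.C : ℂ →+* ℂ⸨X⸩), ← map_natCast (HahnSeries.C : ℂ →+* ℂ⸨X⸩)] at h1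
    exact_mod_cast HahnSeries.C_injective h1

theorem order_coe {u : ℂ⟦X⟧} (hu : constantCoeff u ≠ 0) : (u : ℂ⸨X⸩).order = 0 := by
  have h0 : (u : ℂ⸨X⸩).coeff 0 ≠ 0 := by simpa [coeff_coe] using hu
  refine le_antisymm (HahnSeries.order_le_of_coeff_ne_zero h0) ?_
  by_contra! h
  have h1 : (u : ℂ⸨X⸩).coeff (u : ℂ⸨X⸩).order = 0 := by rw [coeff_coe, if_pos h]
  rw [HahnSeries.coeff_order_eq_zero] at h1
  simp [h1] at h0

/-- A linear relation with constant coefficients between the series `lapSeq f j` modulo the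
meromorphic germs amounts to the convergence of `lap (p f)` for a polynomial `p`. -/
theorem not_linear_relation {f : ℂ⟦X⟧}
    (hf : ∀ p : Polynomial ℂ, IsConvergent (lap ((p : ℂ⟦X⟧) * f)) → p = 0) {n : ℕ}
    {c : Fin n → meromorphicGerms} (hc : c ≠ 0)
    (hconst : ∀ j, ∃ a : ℂ, (c j : ℂ⸨X⸩) = HahnSeries.C a)
    (h : ∑ j, (c j : ℂ⸨X⸩) * lapSeq f j ∈ meromorphicGerms) : False := by
  choose a ha using hconst
  have hsum : ∑ j, (c j : ℂ⸨X⸩) * lapSeq f j = ((X * lap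
      (((∑ j : Fin n, Polynomial.C (a j) * Polynomial.X ^ (j : ℕ) : Polynomial ℂ) : ℂ⟦X⟧) * f) :
      ℂ⟦X⟧) : ℂ⸨X⸩) := by
    rw [← Polynomial.coeToPowerSeries.ringHom_apply, map_sum, Finset.sum_mul, map_sum,
      Finset.mul_sum, map_sum]
    refine Finset.sum_congr rfl fun j _ => ?_
    rw [ha, lapSeq, ← coe_C, ← map_mul]
    congr 1
    simp only [map_mul, map_pow, Polynomial.coeToPowerSeries.ringHom_apply, Polynomial.coe_C,
      Polynomial.coe_X, ← smul_eq_C_mul, smul_mul_assoc, map_smul, mul_smul_comm]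
  rw [hsum] at h
  have h0 := hf _ (isConvergent_of_X_mul h)
  apply hc
  funext j
  have h1 := congrArg (fun p => Polynomial.coeff p j) h0
  simp [Polynomial.coeff_X_pow, Fin.val_inj] at h1
  ext1
  simp [ha, h1]

/-- Differential transcendence of the Laplace transform `g` of `f` when `(α exp t + β) f = N` and
`N` has a convergent Laplace transform: in this case the series `lapSeq f i` satisfy difference
equations with a common constant coefficient `-β / α`, and a minimal algebraic relation between
them is linear with constant coefficients. -/
theorem isDifferentiallyTranscendental_of_exp_mul {f N : ℂ⟦X⟧} {α β : ℂ} (hα : α ≠ 0) (hβ : β ≠ 0)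
    (hfN : (C α * exp ℂ + C β) * f = N) (hN : ∀ i, IsConvergent (lap (X ^ i * N)))
    (hf : ∀ p : Polynomial ℂ, IsConvergent (lap ((p : ℂ⟦X⟧) * f)) → p = 0) :
    IsDifferentiallyTranscendental (lap f : ℂ⸨X⸩) := by
  refine isDifferentiallyTranscendental_lap fun n P hP => ?_
  by_contra hP0
  obtain ⟨m, hm, -⟩ := exists_monomialOrder n
  obtain ⟨Q, hQ⟩ := exists_isMinimalRelation m hP0 hP
  have hτ : ∀ i : ℕ, tau (lapSeq f i) = HahnSeries.C (-β / α) * lapSeq f i +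
      HahnSeries.C α⁻¹ * ((X * lap (X ^ i * N) : ℂ⟦X⟧) : ℂ⸨X⸩) := fun i => by
    rw [lapSeq, tau_X_mul_lap, ← coe_C, ← coe_C, ← map_mul, ← map_mul, ← map_add]
    congr 1
    rw [← hfN, ← smul_eq_C_mul, ← smul_eq_C_mul, ← mul_smul_comm, ← mul_smul_comm, ← map_smul,
      ← map_smul, ← mul_add, ← map_add, smul_eq_C_mul, smul_eq_C_mul]
    congr 2
    have h1 : (C α⁻¹ * C α : ℂ⟦X⟧) = 1 := by rw [← map_mul, inv_mul_cancel₀ hα, map_one]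
    have h2 : (C (-β / α) : ℂ⟦X⟧) = - (C α⁻¹ * C β) := by
      rw [← map_mul, ← map_neg]; congr 1; field_simp
    rw [h2]
    linear_combination (-exp ℂ * (X ^ i * f)) * h1
  let a : meromorphicGerms := ⟨HahnSeries.C (-β / α), C_mem_meromorphicGerms _⟩
  have ha : a ≠ 0 := fun h => by
    have := congrArg Subtype.val h
    simp [a, hα, hβ] at this
  have hb : ∀ i : ℕ, HahnSeries.C α⁻¹ * ((X * lap (X ^ i * N) : ℂ⟦X⟧) : ℂ⸨X⸩) ∈
      meromorphicGerms := fun i =>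
    mul_mem (C_mem_meromorphicGerms _) (coe_mem_meromorphicGerms (isConvergent_X.mul (hN i)))
  have key := hQ.tau_aeval_pderiv (τ := tau) (φ := tauGerm) (a := a) (N := 0)
    (b := fun i : Fin n => ⟨_, hb i⟩) (fun _ => rfl) ha (by simp) (fun i => by
      rw [hτ]
      simp only [Pi.zero_apply, map_zero, zero_mul, Finset.sum_const_zero, add_zero]
      rfl)
  obtain ⟨d, hd⟩ : ∃ d, (m.degree Q).degree = d + 1 :=
    Nat.exists_eq_succ_of_ne_zero fun h => hQ.degree_ne_zero ((Finsupp.degree_eq_zero_iff _).1 h)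
  have hC : algebraMap meromorphicGerms ℂ⸨X⸩ a = HahnSeries.C (-β / α) := rfl
  have hconst : ∀ j, ∃ c : ℂ, MvPolynomial.aeval (fun i : Fin n => lapSeq f i)
      (MvPolynomial.pderiv j Q) = HahnSeries.C c := fun j => by
    have h1 := key j
    simp only [Pi.zero_apply, map_zero, zero_mul, Finset.sum_const_zero, add_zero, hd, pow_succ',
      mul_assoc] at h1
    have h2 := mul_left_cancel₀ ((map_ne_zero _).2 ha) h1
    rw [hC, ← map_pow] at h2
    exact eq_C_of_tau_eq h2
  choose c hc using hconst
  have hlin := hQ.exists_linear (c := fun j => ⟨HahnSeries.C (c j), C_mem_meromorphicGerms _⟩)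
    fun j => hQ.pderiv_eq_C (hc j)
  obtain ⟨k, hk⟩ := hlin.2
  refine not_linear_relation hf hlin.1 (fun j => ⟨c j, rfl⟩) ?_
  have : ∑ j : Fin n, HahnSeries.C (c j) * lapSeq f j = (k : ℂ⸨X⸩) := hk
  rw [this]
  exact k.2

/-- Differential transcendence of the Laplace transform of `f` when `f' = (γ - x exp t) f`: here a
minimal algebraic relation between the series `lapSeq f i` only involves `lapSeq f 0`. -/
theorem isDifferentiallyTranscendental_of_derivative {f : ℂ⟦X⟧} {x γ : ℂ} (hx : x ≠ 0)
    (hfd : d⁄dX ℂ f = (C γ - C x * exp ℂ) * f)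
    (hf : ¬ IsConvergent (lap f)) :
    IsDifferentiallyTranscendental (lap f : ℂ⸨X⸩) := by
  refine isDifferentiallyTranscendental_lap fun n P hP => ?_
  by_contra hP0
  obtain ⟨m, hm, hgr⟩ := exists_monomialOrder n
  obtain ⟨Q, hQ⟩ := exists_isMinimalRelation m hP0 hP
  set A : ℂ⸨X⸩ := HahnSeries.C x⁻¹ * (HahnSeries.C γ - HahnSeries.single (-1) 1) with hA
  have hAm : A ∈ meromorphicGerms := mul_mem (C_mem_meromorphicGerms _)
    (sub_mem (C_mem_meromorphicGerms _) (single_mem_meromorphicGerms _))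
  have hAo : A.order = -1 := by
    have h1 : A = HahnSeries.single (-1) 1 * ((C x⁻¹ * (C γ * X - 1) : ℂ⟦X⟧) : ℂ⸨X⸩) := by
      have h2 : (HahnSeries.single (-1) 1 * HahnSeries.single 1 1 : ℂ⸨X⸩) = 1 := by simp
      rw [hA, map_mul, map_sub, map_mul, coe_C, coe_C, coe_X,
        map_one (HahnSeries.ofPowerSeries ℤ ℂ)]
      linear_combination (-HahnSeries.C x⁻¹ * HahnSeries.C γ) * h2
    have h3 : constantCoeff (C x⁻¹ * (C γ * X - 1) : ℂ⟦X⟧) ≠ 0 := by simp [hx]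
    have h4 := order_coe h3
    rw [h1, HahnSeries.order_mul, h4, HahnSeries.order_single one_ne_zero, add_zero]
    · simp
    · intro h
      rw [map_eq_zero_iff _ HahnSeries.ofPowerSeries_injective] at h
      simp [h] at h3
  have hA0 : A ≠ 0 := fun h => by simp [h] at hAo
  have hτ0 : ∀ i : ℕ, tau (lapSeq f i) = A * lapSeq f i + HahnSeries.C (x⁻¹ * i) * lapSeq f (i - 1) +
      HahnSeries.C (if i = 0 then x⁻¹ * constantCoeff f else 0) := fun i => by
    have h1 : C x * (exp ℂ * (X ^ i * f)) = C γ * (X ^ i * f) - d⁄dX ℂ (X ^ i * f) +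
        C (i : ℂ) * (X ^ (i - 1) * f) := by
      rw [Derivation.leibniz, Derivation.leibniz_pow, hfd, derivative_X, map_natCast]
      simp only [smul_eq_mul, nsmul_eq_mul]
      ring
    have h2 : C x * (X * lap (exp ℂ * (X ^ i * f))) = C γ * (X * lap (X ^ i * f)) -
        (lap (X ^ i * f) - C (constantCoeff (X ^ i * f))) +
        C (i : ℂ) * (X * lap (X ^ (i - 1) * f)) := by
      rw [← X_mul_lap_derivative]
      simp only [← smul_eq_C_mul, ← mul_smul_comm, ← map_smul] at h1 ⊢
      rw [h1, map_add, map_sub]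
      ring
    have h3 := congrArg (HahnSeries.ofPowerSeries ℤ ℂ) h2
    have h4 : (lap (X ^ i * f) : ℂ⸨X⸩) = HahnSeries.single (-1) 1 * lapSeq f i := by
      rw [lapSeq, map_mul (HahnSeries.ofPowerSeries ℤ ℂ), coe_X, ← mul_assoc]; simp
    have h8 : ∀ k, ((X * lap (X ^ k * f) : ℂ⟦X⟧) : ℂ⸨X⸩) = lapSeq f k := fun _ => rfl
    have h5 : constantCoeff (X ^ i * f) = if i = 0 then constantCoeff f else 0 := by
      split_ifs with h <;> simp [h]
    have h6 : (HahnSeries.C x⁻¹ * HahnSeries.C x : ℂ⸨X⸩) = 1 := by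
      rw [← map_mul, inv_mul_cancel₀ hx, map_one]
    have h7 : (HahnSeries.C (if i = 0 then x⁻¹ * constantCoeff f else 0) : ℂ⸨X⸩) =
        HahnSeries.C x⁻¹ * HahnSeries.C (if i = 0 then constantCoeff f else 0) := by
      rw [← map_mul, mul_ite, mul_zero]
    simp only [map_add, map_sub, map_mul (HahnSeries.ofPowerSeries ℤ ℂ) (C _), coe_C, h4] at h3
    simp only [← tau_X_mul_lap, h8, h5] at h3
    rw [h7, map_mul, hA]
    linear_combination HahnSeries.C x⁻¹ * h3 - tau (lapSeq f i) * h6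
  let a : meromorphicGerms := ⟨A, hAm⟩
  have ha : a ≠ 0 := fun h => hA0 (congrArg Subtype.val h)
  let N : Fin n → Fin n → meromorphicGerms := fun i j =>
    if (i : ℕ) = j + 1 then ⟨HahnSeries.C (x⁻¹ * (j + 1)), C_mem_meromorphicGerms _⟩ else 0
  have hNa : ∀ i j : Fin n, algebraMap meromorphicGerms ℂ⸨X⸩ (N i j) =
      if (i : ℕ) = j + 1 then HahnSeries.C (x⁻¹ * (j + 1)) else 0 := fun i j => by
    simp only [N]
    split_ifs
    · rfl
    · simp
  have key := hQ.tau_aeval_pderiv (τ := tau) (φ := tauGerm) (a := a) (N := N)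
    (b := fun i : Fin n => ⟨HahnSeries.C (if (i : ℕ) = 0 then x⁻¹ * constantCoeff f else 0),
      C_mem_meromorphicGerms _⟩) (fun _ => rfl) ha (fun i j h => by
        refine hm j i ?_
        by_contra hij
        refine h (if_neg fun h' => hij ?_)
        rw [Fin.lt_def]; omega) (fun i => by
      rw [hτ0]
      simp only [hNa]
      refine congrArg₂ (· + ·) (congrArg₂ (· + ·) rfl ?_) rfl
      rcases hi : (i : ℕ) with _ | k
      · simp
      · rw [Finset.sum_eq_single ⟨k, by omega⟩]
        · simp
        · intro j _ hj
          rw [if_neg, zero_mul]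
          intro h
          exact hj (Fin.ext (by simp; omega))
        · simp)
  set ℓ : Fin n → ℂ⸨X⸩ := fun j => MvPolynomial.aeval (fun i : Fin n => lapSeq f i)
      (MvPolynomial.pderiv j Q) with hℓ
  set d := (m.degree Q).degree with hd
  have key' : ∀ j : Fin n, A * tau (ℓ j) + ∑ i, algebraMap meromorphicGerms ℂ⸨X⸩ (N i j) * tau (ℓ i) =
      A ^ d * ℓ j := key
  have hd0 : d ≠ 0 := fun h => hQ.degree_ne_zero ((Finsupp.degree_eq_zero_iff _).1 h)
  rcases (show d = 1 ∨ 2 ≤ d by omega) with hd1 | hd2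
  · -- The relation is linear. Its leading variable is `X₀`, because otherwise the coefficient of the
    -- preceding variable would solve an equation excluded by `tau_sub_ne`.
    obtain ⟨i₀, hi₀⟩ := (Finsupp.sum_eq_one_iff _).1 (hd.symm.trans hd1)
    have hpd : ∀ j, MvPolynomial.pderiv j Q =
        MvPolynomial.C (MvPolynomial.coeff (Finsupp.single j 1) Q) := fun j => by
      classical
      refine MvPolynomial.ext _ _ fun e => ?_
      rw [MvPolynomial.coeff_C]
      split_ifs with he
      · subst he
        rw [MvPolynomial.coeff_pderiv]; simp
      · by_contra hne
        have h1 := hgr _ _ (IsMinimalRelation.add_single_le_of_mem_support_pderiv (m := m)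
          (MvPolynomial.mem_support_iff.2 hne))
        rw [map_add, Finsupp.degree_single, ← hd, hd1] at h1
        exact he ((Finsupp.degree_eq_zero_iff _).1 (by omega)).symm
    have hlt : ∀ j, i₀ < j → MvPolynomial.coeff (Finsupp.single j 1) Q = 0 := fun j hj =>
      m.coeff_eq_zero_of_lt (by rw [hi₀]; exact hm _ _ hj)
    have hone : MvPolynomial.coeff (Finsupp.single i₀ 1) Q = 1 := by
      rw [← hi₀]; exact hQ.monic.coeff_degree
    rcases hk : (i₀ : ℕ) with _ | k
    · obtain ⟨-, g, hg⟩ := hQ.exists_linear hpd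
      rw [Finset.sum_eq_single i₀ (fun j _ hj => by
        rw [hlt j (by rw [Fin.lt_def]; have := Fin.val_ne_of_ne hj; omega), map_zero, zero_mul])
        (by simp), hone, map_one, one_mul, hk, lapSeq, pow_zero, one_mul] at hg
      exact hf (isConvergent_of_X_mul (by rw [hg]; exact g.2))
    · have h1 := key' ⟨k, by omega⟩
      rw [Finset.sum_eq_single i₀ (fun j _ hj => by
        rw [hNa, if_neg fun h => hj (Fin.ext (by rw [h, hk])), zero_mul]) (by simp), hNa,
        if_pos hk, hd1, pow_one] at h1
      have h2 : ℓ i₀ = 1 := by simp [hℓ, hpd, hone]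
      rw [h2, map_one, mul_one] at h1
      set z := ℓ ⟨k, by omega⟩
      have h3 : (tau z - z) * A = HahnSeries.C (-(x⁻¹ * (k + 1))) := by
        rw [map_neg]
        linear_combination h1
      have h4 : -(x⁻¹ * ((k : ℂ) + 1)) ≠ 0 :=
        neg_ne_zero.2 (mul_ne_zero (inv_ne_zero hx) (Nat.cast_add_one_ne_zero k))
      have h5 : tau z - z ≠ 0 := fun h => by
        rw [h, zero_mul, eq_comm, _root_.map_eq_zero] at h3
        exact h4 h3
      have h6 := congrArg HahnSeries.order h3
      rw [HahnSeries.order_mul h5 hA0, HahnSeries.order_C, hAo] at h6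
      exact tau_sub_ne (z := z) (w := tau z - z) (by omega) rfl
  · -- Comparing orders, all the partial derivatives of the relation vanish.
    have hz : ∀ k : ℕ, ∀ j : Fin n, n ≤ j + k → ℓ j = 0 := by
      intro k
      induction k with
      | zero => intro j hj; omega
      | succ k ih =>
        intro j hj
        have h1 := key' j
        rw [Finset.sum_eq_zero, add_zero] at h1
        · obtain ⟨e, he⟩ : ∃ e, d = e + 1 := ⟨d - 1, by omega⟩
          rw [he, pow_succ', mul_assoc A (A ^ e)] at h1
          exact eq_zero_of_tau_eq (a := A) (k := e) (by omega) (by omega) (mul_left_cancel₀ hA0 h1)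
        · intro i _
          rw [hNa]
          split_ifs with h
          · rw [ih i (by omega)]; simp
          · simp
    refine (hQ.exists_linear (c := 0) fun j => hQ.pderiv_eq_C ?_).1 rfl
    simpa [hℓ] using hz n j (by omega)

end

/-! ### Laplace transforms and entire functions -/

section

open PowerSeries

/-- Convergence of the Laplace transform is stable under products, by the binomial formula. -/
theorem IsConvergent.lap_mul {f g : ℂ⟦X⟧} (hf : IsConvergent (lap f)) (hg : IsConvergent (lap g)) :
    IsConvergent (lap (f * g)) := by
  obtain ⟨C, ρ, hC, hρ, h⟩ := isConvergent_iff.1 hf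
  obtain ⟨D, σ, hD, hσ, k⟩ := isConvergent_iff.1 hg
  refine isConvergent_iff.2 ⟨C * D, ρ + σ, by positivity, by positivity, fun n => ?_⟩
  rw [coeff_lap, coeff_mul, (Commute.all ρ σ).add_pow', Finset.mul_sum, Finset.mul_sum]
  refine (norm_sum_le _ _).trans (Finset.sum_le_sum fun p hp => ?_)
  have hp' : p.1 + p.2 = n := Finset.HasAntidiagonal.mem_antidiagonal.1 hp
  have h1 : (n.factorial : ℂ) * (coeff p.1 f * coeff p.2 g) =
      (n.choose p.1 : ℂ) * (coeff p.1 (lap f) * coeff p.2 (lap g)) := by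
    rw [← hp', Nat.choose_symm_add, coeff_lap, coeff_lap, ← Nat.add_choose_mul_factorial_mul_factorial]
    push_cast; ring
  rw [h1, norm_mul, norm_mul, Complex.norm_natCast, nsmul_eq_mul]
  calc (n.choose p.1 : ℝ) * (‖coeff p.1 (lap f)‖ * ‖coeff p.2 (lap g)‖)
      ≤ n.choose p.1 * ((C * ρ ^ p.1) * (D * σ ^ p.2)) := by gcongr; exacts [h _, k _]
    _ = C * D * (n.choose p.1 * (ρ ^ p.1 * σ ^ p.2)) := by ring

theorem isConvergent_lap_C (a : ℂ) : IsConvergent (lap (C a)) := by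
  convert isConvergent_C a using 1
  ext n
  rcases n with _ | n
  · rw [coeff_lap]; simp
  · rw [coeff_lap, coeff_C, if_neg n.succ_ne_zero, mul_zero]

theorem isConvergent_lap_X : IsConvergent (lap X) := by
  convert isConvergent_X using 1
  ext n
  rw [coeff_lap, coeff_X]
  split_ifs with h <;> simp [h]

theorem isConvergent_lap_exp (a : ℂ) : IsConvergent (lap (rescale a (exp ℂ))) := by
  refine isConvergent_iff.2 ⟨1, ‖a‖, zero_le_one, norm_nonneg _, fun n => ?_⟩
  have := Nat.cast_ne_zero (R := ℂ).2 n.factorial_ne_zero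
  rw [coeff_lap, coeff_rescale, coeff_exp]
  simp
  field_simp
  simp

/-- The power series `f` converges on all of `ℂ`, with sum `g`. -/
def HasEntireSum (f : ℂ⟦X⟧) (g : ℂ → ℂ) : Prop :=
  ∀ z : ℂ, HasSum (fun n => coeff n f * z ^ n) (g z)

namespace HasEntireSum

variable {f₁ f₂ : ℂ⟦X⟧} {g₁ g₂ : ℂ → ℂ}

theorem add (h₁ : HasEntireSum f₁ g₁) (h₂ : HasEntireSum f₂ g₂) :
    HasEntireSum (f₁ + f₂) (fun z => g₁ z + g₂ z) := fun z => by
  simpa [add_mul] using (h₁ z).add (h₂ z)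

theorem mul (h₁ : HasEntireSum f₁ g₁) (h₂ : HasEntireSum f₂ g₂) :
    HasEntireSum (f₁ * f₂) (fun z => g₁ z * g₂ z) := fun z => by
  have s₁ := summable_norm_iff.2 (h₁ z).summable
  have s₂ := summable_norm_iff.2 (h₂ z).summable
  have h : (fun n => coeff n (f₁ * f₂) * z ^ n) = fun n => ∑ p ∈ Finset.HasAntidiagonal.antidiagonal n,
      (coeff p.1 f₁ * z ^ p.1) * (coeff p.2 f₂ * z ^ p.2) := by
    funext n
    rw [coeff_mul, Finset.sum_mul]
    refine Finset.sum_congr rfl fun p hp => ?_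
    rw [← Finset.HasAntidiagonal.mem_antidiagonal.1 hp, pow_add]; ring
  change HasSum _ (g₁ z * g₂ z)
  rw [h, ← (h₁ z).tsum_eq, ← (h₂ z).tsum_eq,
    tsum_mul_tsum_eq_tsum_sum_antidiagonal_of_summable_norm s₁ s₂]
  exact (summable_norm_sum_mul_antidiagonal_of_summable_norm s₁ s₂).of_norm.hasSum

theorem C (a : ℂ) : HasEntireSum (C a) (fun _ => a) := fun z => by
  convert hasSum_single 0 (fun n hn => ?_) using 1
  · simp
  · simp [coeff_C, hn]

theorem X : HasEntireSum X (fun z => z) := fun z => by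
  convert hasSum_single 1 (fun n hn => ?_) using 1
  · simp
  · simp [coeff_X, hn]

theorem exp (a : ℂ) : HasEntireSum (rescale a (exp ℂ)) (fun z => Complex.exp (a * z)) := fun z => by
  rw [Complex.exp_eq_exp_ℂ]
  have h : (fun n => coeff n (rescale a (PowerSeries.exp ℂ)) * z ^ n) =
      fun n : ℕ => (a * z) ^ n / n.factorial := by
    funext n
    rw [coeff_rescale, coeff_exp]
    simp
    ring
  rw [h]
  exact NormedSpace.expSeries_div_hasSum_exp (a * z)

theorem polynomial (p : Polynomial ℂ) : HasEntireSum (p : ℂ⟦X⟧) (fun z => p.eval z) := by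
  induction p using Polynomial.induction_on' with
  | add p q hp hq => simpa using hp.add hq
  | monomial n a =>
    intro z
    convert hasSum_single n (fun k hk => ?_) using 1
    · simp
    · rw [Polynomial.coeff_coe, Polynomial.coeff_monomial, if_neg hk.symm, zero_mul]

/-- A power series with a convergent Laplace transform is an entire function of exponential type. -/
theorem of_isConvergent_lap {f : ℂ⟦X⟧} (hf : IsConvergent (lap f)) :
    ∃ (g : ℂ → ℂ) (A ρ : ℝ), HasEntireSum f g ∧ ∀ z, ‖g z‖ ≤ A * Real.exp (ρ * ‖z‖) := by
  obtain ⟨A, ρ, hA, hρ, h⟩ := isConvergent_iff.1 hf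
  have hb : ∀ (z : ℂ) (n : ℕ), ‖coeff n f * z ^ n‖ ≤ A * ((ρ * ‖z‖) ^ n / n.factorial) := by
    intro z n
    have h1 := h n
    rw [coeff_lap, norm_mul, Complex.norm_natCast] at h1
    have h2 : (0 : ℝ) < n.factorial := by exact_mod_cast n.factorial_pos
    rw [norm_mul, norm_pow, mul_pow, ← mul_div_assoc, le_div_iff₀ h2]
    calc _ = (n.factorial * ‖coeff n f‖) * ‖z‖ ^ n := by ring
      _ ≤ A * ρ ^ n * ‖z‖ ^ n := by gcongr
      _ = _ := by ring
  have he : ∀ z : ℂ, HasSum (fun n : ℕ => A * ((ρ * ‖z‖) ^ n / n.factorial))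
      (A * Real.exp (ρ * ‖z‖)) := fun z => by
    rw [Real.exp_eq_exp_ℝ]
    exact (NormedSpace.expSeries_div_hasSum_exp (ρ * ‖z‖)).mul_left A
  refine ⟨fun z => ∑' n, coeff n f * z ^ n, A, ρ, fun z => ?_, fun z => ?_⟩
  · exact (Summable.of_norm_bounded (he z).summable (hb z)).hasSum
  · exact tsum_of_norm_bounded (he z) (hb z)

end HasEntireSum

end

/-! ### Generating functions with denominator `α exp(t) + β` -/

section

open PowerSeries

theorem infinite_exp_roots {α β : ℂ} (hα : α ≠ 0) (hβ : β ≠ 0) :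
    {z : ℂ | α * Complex.exp z + β = 0}.Infinite := by
  refine Set.infinite_of_injective_forall_mem
    (f := fun k : ℕ => Complex.log (-β / α) + k * (2 * Real.pi * Complex.I)) (fun k l h => ?_)
    fun k => ?_
  · have := mul_right_cancel₀ Complex.two_pi_I_ne_zero (add_left_cancel h)
    exact_mod_cast this
  · have h1 : Complex.exp (k * (2 * Real.pi * Complex.I)) = 1 := by
      simp
    simp only [Set.mem_ofPred_eq]
    rw [Complex.exp_add, h1, Complex.exp_log (div_ne_zero (neg_ne_zero.2 hβ) hα)]
    field_simp
    ring

theorem infinite_exp_roots_of_ne_zero {α β : ℂ} (hα : α ≠ 0) (hβ : β ≠ 0) {g : ℂ → ℂ}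
    (hg : ∀ z ≠ 0, g z ≠ 0) : {z : ℂ | α * Complex.exp z + β = 0 ∧ g z ≠ 0}.Infinite :=
  ((infinite_exp_roots hα hβ).sdiff (Set.finite_singleton 0)).mono fun z hz => ⟨hz.1, hg z hz.2⟩

/-- Quotients by `α exp(t) + β` are power series, also when the denominator has a simple zero at
`0`, provided the numerator vanishes there. -/
theorem exists_mul_eq {α β : ℂ} (hα : α ≠ 0) {N : ℂ⟦X⟧} (hN : α + β = 0 → constantCoeff N = 0) :
    ∃ f : ℂ⟦X⟧, (C α * exp ℂ + C β) * f = N := by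
  by_cases h : α + β = 0
  · obtain ⟨N', rfl⟩ := X_dvd_iff.2 (hN h)
    obtain ⟨D, hD⟩ : X ∣ C α * exp ℂ + C β := X_dvd_iff.2 (by simp [h])
    have h1 : constantCoeff D ≠ 0 := by
      have := congrArg (coeff 1) hD
      rw [← zero_add 1, coeff_succ_X_mul, coeff_zero_eq_constantCoeff_apply] at this
      rw [← this]
      simpa [coeff_C] using hα
    exact ⟨D⁻¹ * N', by rw [hD, mul_assoc, ← mul_assoc D, PowerSeries.mul_inv_cancel _ h1, one_mul]⟩
  · refine ⟨(C α * exp ℂ + C β)⁻¹ * N, ?_⟩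
    rw [← mul_assoc, PowerSeries.mul_inv_cancel _ (by simpa using h), one_mul]

theorem ogf_eq_lap {F : Family} {x γ : ℂ} {f : ℂ⟦X⟧} (h : egf F x γ = (f : ℂ⸨X⸩)) :
    ogf F x γ = lap f := by
  ext n
  rw [ogf, coeff_mk, coeff_lap, polyValue, h, coeff_coe, if_neg (by omega), Int.natAbs_natCast]

/-- The case of an exponential generating function `N / (α exp(t) + β)` with infinitely many
poles. -/
theorem isDifferentiallyTranscendental_of_egf_eq_div {F : Family} {x γ α β : ℂ} {N : ℂ⟦X⟧}
    {g : ℂ → ℂ} (hα : α ≠ 0) (hβ : β ≠ 0)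
    (hF : egf F x γ = (N : ℂ⸨X⸩) / (HahnSeries.C α * expMul 1 + HahnSeries.C β))
    (hN0 : α + β = 0 → constantCoeff N = 0) (hN : IsConvergent (lap N)) (hg : HasEntireSum N g)
    (hinf : {z : ℂ | α * Complex.exp z + β = 0 ∧ g z ≠ 0}.Infinite) :
    IsDifferentiallyTranscendental (ogf F x γ : ℂ⸨X⸩) := by
  obtain ⟨f, hf⟩ := exists_mul_eq hα hN0
  have hD : (HahnSeries.C α * expMul 1 + HahnSeries.C β : ℂ⸨X⸩) =
      ((C α * exp ℂ + C β : ℂ⟦X⟧) : ℂ⸨X⸩) := by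
    rw [expMul, rescale_one, map_add, map_mul, coe_C, coe_C]; rfl
  have hD0 : ((C α * exp ℂ + C β : ℂ⟦X⟧) : ℂ⸨X⸩) ≠ 0 := by
    rw [Ne, map_eq_zero_iff _ HahnSeries.ofPowerSeries_injective]
    intro h
    have := congrArg (coeff 1) h
    simp [hα] at this
  rw [hD, ← hf, map_mul, mul_div_cancel_left₀ _ hD0] at hF
  rw [ogf_eq_lap hF]
  refine isDifferentiallyTranscendental_of_exp_mul hα hβ hf (fun i => ?_) fun p hp => ?_
  · induction i with
    | zero => simpa using hN
    | succ i ih => rw [pow_succ', mul_assoc]; exact isConvergent_lap_X.lap_mul ih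
  -- Evaluate `(α exp t + β) p f = p N` at the zeros of `α exp t + β`.
  obtain ⟨h, -, -, hh, -⟩ := HasEntireSum.of_isConvergent_lap hp
  refine Polynomial.eq_zero_of_infinite_isRoot p (hinf.mono fun z hz => ?_)
  have hexp : HasEntireSum (exp ℂ) (fun z => Complex.exp z) := by
    simpa [rescale_one] using HasEntireSum.exp 1
  have h1 := ((((HasEntireSum.C α).mul hexp).add (HasEntireSum.C β)).mul hh) z
  have h2 := ((HasEntireSum.polynomial p).mul hg) z
  rw [show (C α * exp ℂ + C β) * ((p : ℂ⟦X⟧) * f) = (p : ℂ⟦X⟧) * N by rw [← hf]; ring] at h1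
  have h3 := h1.unique h2
  simp only [hz.1, zero_mul] at h3
  exact (mul_eq_zero.1 h3.symm).resolve_right hz.2

/-- Of two consecutive non-zero multiples of `2πi`, at least one is a pole of
`z (exp(xz) - 1) / (exp z - 1)` when `x` is not an integer. -/
theorem infinite_imschenetsky {x : ℂ} (hx : ∀ m : ℤ, x ≠ m) :
    {z : ℂ | 1 * Complex.exp z + -1 = 0 ∧ z * (Complex.exp (x * z) + -1) ≠ 0}.Infinite := by
  have hinj : Function.Injective fun k : ℕ => (k : ℂ) * (2 * Real.pi * Complex.I) := fun k l h => by
    exact_mod_cast mul_right_cancel₀ Complex.two_pi_I_ne_zero h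
  have hS : {k : ℕ | k ≠ 0 ∧ Complex.exp (x * (k * (2 * Real.pi * Complex.I))) ≠ 1}.Infinite := by
    refine Set.infinite_of_forall_exists_gt fun n => ?_
    by_contra! h
    have key : ∀ k : ℕ, n < k → Complex.exp (x * (k * (2 * Real.pi * Complex.I))) = 1 :=
      fun k hk => by
        by_contra hne
        exact absurd hk (not_lt.2 (h k ⟨by omega, hne⟩))
    have h1 := key (n + 1) (by omega)
    have h2 := key (n + 1 + 1) (by omega)
    rw [Nat.cast_succ, add_one_mul, mul_add, Complex.exp_add, h1, one_mul,
      Complex.exp_eq_one_iff] at h2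
    obtain ⟨m, hm⟩ := h2
    exact hx m (mul_right_cancel₀ Complex.two_pi_I_ne_zero hm)
  refine (hS.image hinj.injOn).mono ?_
  rintro _ ⟨k, ⟨hk, hne⟩, rfl⟩
  have h1 : Complex.exp (k * (2 * Real.pi * Complex.I)) = 1 := by simp
  refine ⟨by simp only [h1]; ring, mul_ne_zero (mul_ne_zero (by exact_mod_cast hk)
    Complex.two_pi_I_ne_zero) fun h => hne (by linear_combination h)⟩

end

/-! ### Generating functions that are exponentials of exponentials -/

section

open PowerSeries

/-- The formal solution of `f' = (γ - x exp(t)) f` is the Taylor series at `0` of the analytic one: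
Leibniz's rule gives the same recursion for the coefficients. -/
theorem hasEntireSum_exp_exp {f : ℂ⟦X⟧} {x γ : ℂ} (hf0 : constantCoeff f = 1)
    (hfd : d⁄dX ℂ f = (C γ - C x * exp ℂ) * f) :
    HasEntireSum f (fun z => Complex.exp (-x * Complex.exp z + γ * z + x)) := by
  set G : ℂ → ℂ := fun z => Complex.exp (-x * Complex.exp z + γ * z + x) with hG
  set E : ℂ → ℂ := fun z => γ - x * Complex.exp z with hE
  have hGd : Differentiable ℂ G := by fun_prop
  have hEd : Differentiable ℂ E := by fun_prop
  have hGE : deriv G = E * G := by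
    funext z
    have h1 : HasDerivAt (fun z => -x * Complex.exp z + γ * z + x) (-x * Complex.exp z + γ * 1) z :=
      (((Complex.hasDerivAt_exp z).const_mul (-x)).add ((hasDerivAt_id z).const_mul γ)).add_const x
    rw [h1.cexp.deriv, Pi.mul_apply, hE, hG]
    ring
  have hEc : ∀ i, iteratedDeriv i E 0 = (i.factorial : ℂ) * coeff i (C γ - C x * exp ℂ) := by
    intro i
    rcases i with _ | i
    · simp [hE]
    · have h1 : deriv E = fun z => -x * Complex.exp z := by
        funext z
        have := ((Complex.hasDerivAt_exp z).const_mul x).const_sub γ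
        rw [this.deriv]; ring
      rw [iteratedDeriv_succ', h1, iteratedDeriv_const_mul_field, iteratedDeriv_eq_iterate,
        Complex.iter_deriv_exp]
      have := Nat.cast_ne_zero (R := ℂ).2 (i + 1).factorial_ne_zero
      simp
      field_simp
  have hGc : ∀ n, iteratedDeriv n G 0 = (n.factorial : ℂ) * coeff n f := by
    intro n
    induction n using Nat.strong_induction_on with
    | _ n ih =>
      rcases n with _ | n
      · simp [hG, hf0]
      · have h1 : coeff n (d⁄dX ℂ f) = _ := congrArg (coeff n) hfd
        rw [coeff_derivative, coeff_mul, Finset.Nat.sum_antidiagonal_eq_sum_range_succ_mk] at h1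
        rw [iteratedDeriv_succ', hGE, iteratedDeriv_mul hEd.contDiff.contDiffAt
          hGd.contDiff.contDiffAt, Nat.factorial_succ]
        push_cast
        rw [show ((n : ℂ) + 1) * n.factorial * coeff (n + 1) f =
          n.factorial * (coeff (n + 1) f * (n + 1)) by ring, h1, Finset.mul_sum]
        refine Finset.sum_congr rfl fun i hi => ?_
        have hi : i ≤ n := by simpa [Nat.lt_succ_iff] using hi
        rw [hEc, ih (n - i) (by omega), ← Nat.choose_mul_factorial_mul_factorial hi]
        push_cast; ring
  intro z
  have h : (fun n => coeff n f * z ^ n) =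
      fun n : ℕ => (n.factorial : ℂ)⁻¹ • (z - 0) ^ n • iteratedDeriv n G 0 := by
    funext n
    have := Nat.cast_ne_zero (R := ℂ).2 n.factorial_ne_zero
    rw [hGc, sub_zero, smul_eq_mul, smul_eq_mul]
    field_simp
  rw [h]
  exact Complex.hasSum_taylorSeries_of_entire hGd 0 z

/-- The function `exp(-x exp(z) + γ z + x)` grows faster than any `exp(ρ |z|)`. -/
theorem not_isConvergent_lap_exp_exp {f : ℂ⟦X⟧} {x γ : ℂ} (hx : x ≠ 0) (hf0 : constantCoeff f = 1)
    (hfd : d⁄dX ℂ f = (C γ - C x * exp ℂ) * f) : ¬ IsConvergent (lap f) := by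
  intro hf
  obtain ⟨g, A, ρ, hg, hb⟩ := HasEntireSum.of_isConvergent_lap hf
  have hgz : ∀ z, g z = Complex.exp (-x * Complex.exp z + γ * z + x) := fun z =>
    (hg z).unique (hasEntireSum_exp_exp hf0 hfd z)
  -- On the half-line `w + ℝ₊` the function `-x exp` takes the values `exp r`.
  set w := Complex.log (-x⁻¹) with hw
  have hre : ∀ r : ℝ, 0 ≤ r → Real.exp r ≤
      Real.log (|A| + 1) + (|ρ| + ‖γ‖) * (‖w‖ + r) + ‖x‖ := fun r hr => by
    have h1 := hb (w + r)
    have h2 : -x * Complex.exp (w + r) = (Real.exp r : ℝ) := by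
      rw [Complex.exp_add, hw, Complex.exp_log (neg_ne_zero.2 (inv_ne_zero hx)),
        Complex.ofReal_exp]
      field_simp
    have hn : ‖w + r‖ ≤ ‖w‖ + r := (norm_add_le _ _).trans (by
      rw [Complex.norm_real, Real.norm_of_nonneg hr])
    rw [hgz, h2, Complex.norm_exp] at h1
    have h3 : -(‖γ‖ * (‖w‖ + r) + ‖x‖) ≤ (γ * (w + r) + x).re := by
      have := (Complex.abs_re_le_norm (γ * (w + r) + x)).trans (norm_add_le _ _)
      rw [norm_mul] at this
      have h4 : ‖γ‖ * ‖w + r‖ ≤ ‖γ‖ * (‖w‖ + r) := by gcongr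
      linarith [neg_abs_le (γ * (w + r) + x).re]
    have h5 : A * Real.exp (ρ * ‖w + r‖) ≤ (|A| + 1) * Real.exp (|ρ| * (‖w‖ + r)) := by
      gcongr
      · linarith [le_abs_self A]
      · exact le_abs_self ρ
    have h6 := h1.trans h5
    rw [← Real.exp_log (show 0 < |A| + 1 by positivity), ← Real.exp_add, Real.exp_le_exp,
      Complex.add_re, Complex.add_re, Complex.ofReal_re] at h6
    rw [Complex.add_re] at h3
    linarith
  set B := |ρ| + ‖γ‖
  set L := Real.log (|A| + 1) + B * ‖w‖ + ‖x‖
  have hB : 0 ≤ B := by positivity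
  have hr0 : 0 ≤ 2 * (|L| + B) := by positivity
  have h1 := hre _ hr0
  have h2 := Real.quadratic_le_exp_of_nonneg hr0
  have h3 := le_abs_self L
  have h4 := abs_nonneg L
  simp only [L, B] at *
  nlinarith

/-- The case of an exponential generating function `exp(-x exp(t) + γ t + x)`. -/
theorem isDifferentiallyTranscendental_of_egf_eq_expOf {F : Family} {x γ x' γ' : ℂ} (hx : x ≠ 0)
    (hF : egf F x' γ' = expOf (-C x * exp ℂ + C γ * X + C x)) :
    IsDifferentiallyTranscendental (ogf F x' γ' : ℂ⸨X⸩) := by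
  have hs : HasSubst (-C x * exp ℂ + C γ * X + C x) := HasSubst.of_constantCoeff_zero' (by simp)
  have hd : d⁄dX ℂ ((exp ℂ).subst (-C x * exp ℂ + C γ * X + C x)) =
      (C γ - C x * exp ℂ) * (exp ℂ).subst (-C x * exp ℂ + C γ * X + C x) := by
    rw [derivative_subst hs, derivative_exp, mul_comm]
    congr 1
    simp [derivative_C, derivative_exp]
    ring
  have h0 : constantCoeff ((exp ℂ).subst (-C x * exp ℂ + C γ * X + C x)) = 1 := by
    have hg : constantCoeff (-C x * exp ℂ + C γ * X + C x) = 0 := by simp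
    generalize -C x * exp ℂ + C γ * X + C x = g at hs hg
    rw [eq_X_mul_shift_add_const (exp ℂ), subst_add hs, subst_mul hs, subst_X hs, subst_C]
    change constantCoeff (g * _ + C _) = 1
    simp [hg]
  rw [ogf_eq_lap hF]
  exact isDifferentiallyTranscendental_of_derivative hx hd (not_isConvergent_lap_exp_exp hx h0 hd)

end

/-! ### The families -/

section

open PowerSeries

theorem isDifferentiallyTranscendental_ogf (F : Family) {x γ : ℂ} (hx : x ≠ 0) (hγ : γ ≠ 0)
    (hImschenetsky : F = Family.imschenetsky → ∀ m : ℤ, x ≠ (m : ℂ))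
    (hCarlitz : F = Family.carlitz → γ ≠ 1) (hFubini : F = Family.fubini → x ≠ -1) :
    IsDifferentiallyTranscendental (ogf F x γ : ℂ⸨X⸩) := by
  have he := isConvergent_lap_exp x
  have hX := isConvergent_lap_X
  have hC := isConvergent_lap_C
  have hE := HasEntireSum.exp x
  have h2 : ((C 2 : ℂ⟦X⟧) : ℂ⸨X⸩) = 2 := by
    rw [coe_C]
    exact map_ofNat (HahnSeries.C : ℂ →+* ℂ⸨X⸩) 2
  cases F with
  | bernoulli =>
    refine isDifferentiallyTranscendental_of_egf_eq_div (α := 1) (β := -1)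
      (N := X * rescale x (exp ℂ)) one_ne_zero (by simp) ?_ (by simp) (hX.lap_mul he)
      (HasEntireSum.X.mul hE) (infinite_exp_roots_of_ne_zero one_ne_zero (by simp) fun z hz => by
        simpa using hz)
    simp [egf, tt, expMul, div_mul_eq_mul_div, sub_eq_add_neg]
  | glaisher =>
    refine isDifferentiallyTranscendental_of_egf_eq_div (α := 1) (β := 1)
      (N := X * rescale x (exp ℂ)) one_ne_zero one_ne_zero ?_ (by simp) (hX.lap_mul he)
      (HasEntireSum.X.mul hE) (infinite_exp_roots_of_ne_zero one_ne_zero (by simp) fun z hz => by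
        simpa using hz)
    simp [egf, tt, expMul, div_mul_eq_mul_div]
  | apostolBernoulli =>
    refine isDifferentiallyTranscendental_of_egf_eq_div (α := γ) (β := -1)
      (N := X * rescale x (exp ℂ)) hγ (by simp) ?_ (by simp) (hX.lap_mul he)
      (HasEntireSum.X.mul hE) (infinite_exp_roots_of_ne_zero hγ (by simp) fun z hz => by
        simpa using hz)
    simp [egf, tt, expMul, div_mul_eq_mul_div, sub_eq_add_neg]
  | imschenetsky =>
    refine isDifferentiallyTranscendental_of_egf_eq_div (α := 1) (β := -1)
      (N := X * (rescale x (exp ℂ) + C (-1))) one_ne_zero (by simp) ?_ (by simp)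
      (hX.lap_mul (by rw [map_add]; exact he.add (hC _)))
      (HasEntireSum.X.mul (hE.add (HasEntireSum.C (-1))))
      (infinite_imschenetsky (hImschenetsky rfl))
    simp [egf, tt, expMul, div_mul_eq_mul_div, sub_eq_add_neg]
  | euler =>
    refine isDifferentiallyTranscendental_of_egf_eq_div (α := 1) (β := 1)
      (N := C 2 * rescale x (exp ℂ)) one_ne_zero one_ne_zero ?_ (by norm_num) ((hC 2).lap_mul he)
      ((HasEntireSum.C 2).mul hE) (infinite_exp_roots_of_ne_zero one_ne_zero (by simp) fun z hz => by
        simp)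
    simp only [map_mul (HahnSeries.ofPowerSeries ℤ ℂ), h2]
    simp [egf, expMul, div_mul_eq_mul_div]
  | genocchi =>
    refine isDifferentiallyTranscendental_of_egf_eq_div (α := 1) (β := 1)
      (N := C 2 * X * rescale x (exp ℂ)) one_ne_zero one_ne_zero ?_ (by simp)
      (((hC 2).lap_mul hX).lap_mul he)
      (((HasEntireSum.C 2).mul HasEntireSum.X).mul hE)
      (infinite_exp_roots_of_ne_zero one_ne_zero (by simp) fun z hz => by simpa using hz)
    simp only [map_mul (HahnSeries.ofPowerSeries ℤ ℂ), h2]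
    simp [egf, tt, expMul, div_mul_eq_mul_div]
  | carlitz =>
    have h1 : 1 - γ ≠ 0 := sub_ne_zero.2 (hCarlitz rfl).symm
    refine isDifferentiallyTranscendental_of_egf_eq_div (α := -γ) (β := 1)
      (N := C (1 - γ) * rescale x (exp ℂ)) (neg_ne_zero.2 hγ) one_ne_zero ?_
      (fun h => absurd (by linear_combination h) h1) ((hC _).lap_mul he)
      ((HasEntireSum.C _).mul hE)
      (infinite_exp_roots_of_ne_zero (neg_ne_zero.2 hγ) one_ne_zero fun z hz => by simpa using h1)
    simp [egf, expMul, div_mul_eq_mul_div, sub_eq_neg_add]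
  | fubini =>
    have h1 : 1 + x ≠ 0 := fun h => hFubini rfl (by linear_combination h)
    refine isDifferentiallyTranscendental_of_egf_eq_div (α := -x) (β := 1 + x)
      (N := C 1) (neg_ne_zero.2 hx) h1 ?_
      (fun h => absurd h (by simp)) (hC 1) (HasEntireSum.C 1)
      (infinite_exp_roots_of_ne_zero (neg_ne_zero.2 hx) h1 fun z hz => by simp)
    simp only [egf, map_one, map_neg, map_add]
    congr 1
    ring
  -- The Bell–Touchard and Mahler families are the Toscano family with parameters `(-x, 0)` and
  -- `(x, x)`.
  | bellTouchard =>
    refine isDifferentiallyTranscendental_of_egf_eq_expOf (x := -x) (γ := 0) (neg_ne_zero.2 hx) ?_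
    rw [egf]
    congr 1
    simp
    ring
  | mahler =>
    refine isDifferentiallyTranscendental_of_egf_eq_expOf (x := x) (γ := x) hx ?_
    rw [egf]
    congr 1
    ring
  | toscano => exact isDifferentiallyTranscendental_of_egf_eq_expOf hx rfl

end

end StrongDT

end

theorem corollary1p3 (F : StrongDT.Family) (x γ : ℂ) (hx : x ≠ 0) (hγ : γ ≠ 0)
    (hImschenetsky : F = StrongDT.Family.imschenetsky → ∀ m : ℤ, x ≠ (m : ℂ))
    (hCarlitz : F = StrongDT.Family.carlitz → γ ≠ 1)
    (hFubini : F = StrongDT.Family.fubini → x ≠ -1) :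
    StrongDT.IsDifferentiallyTranscendental
      ((StrongDT.ogf F x γ : PowerSeries ℂ) : LaurentSeries ℂ) := by
  exact StrongDT.isDifferentiallyTranscendental_ogf F hx hγ hImschenetsky hCarlitz hFubini
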